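/- Let $\Bbbk$ be a field, $r\in\mathbb N=\{0,1,2,\dots\}$, $\mathbf n=(n_1,\dots,n_r)\in\mathbb N^r$, and let $S=\Bbbk[x_{i,j}\mid 1\le i\le r,\ 0\le j\le n_i]$ with the $\mathbb Z^r$-grading $\deg x_{i,j}=\mathbf e_i$ (the Cox ring of $\mathbb P^{n_1}\times\cdots\times\mathbb P^{n_r}$). Write $\mathbf v\le\mathbf w$ for the componentwise order on $\mathbb Z^r$ and $\mathbf 1=(1,\dots,1)$. For $\mathbf d\in\mathbb Z^r$ and $i\in\mathbb N$ let \[ L_i(\mathbf d)=\bigcup_{\lambda\in\mathbb N^r,\ \lambda_1+\cdots+\lambda_r=i}\left(\mathbf d-\lambda_1\mathbf e_1-\cdots-\lambda_r\mathbf e_r+\mathbb N^r\right), \] \[ Q_0(\mathbf d)=\mathbf d+\mathbb N^r,\qquad Q_i(\mathbf d)=L_{i-1}(\mathbf d-\mathbf 1)\quad\text{for } i>0. \] A $\mathbb Z^r$-graded free resolution $F_\bullet$ (not necessarily minimal, with terms of possibly infinite rank) is called \emph{linear} (respectively \emph{quasilinear}) if there is $\mathbf e\in\mathbb Z^r$ such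 that $F_0$ is generated in the single multidegree $\mathbf e$ and, for each $j\ge 0$, all twists $\mathbf b$ of summands $S(\mathbf b)$ of $F_j$ lie in $L_j(-\mathbf e)$ (respectively in $Q_j(-\mathbf e)$). Let $M$ be a $\mathbb Z^r$-graded $S$-module and, for $\mathbf d\in\mathbb Z^r$, let $M_{\ge\mathbf d}=\bigoplus_{\mathbf d''\ge\mathbf d}M_{\mathbf d''}$ be its truncation, with the grading inherited from $M$. Let $\mathbf d\le\mathbf d'$ in $\mathbb Z^r$. (1) If $M_{\ge\mathbf d}$ has a linear resolution, then $M_{\ge\mathbf d'}$ has a linear resolution. (2) If $M_{\ge\mathbf d}$ has a quasilinear resolution, then $M_{\ge\mathbf d'}$ has a quasilinear resolution. -/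

import Mathlib

namespace Multigraded

universe u v w

/-- The Cox ring `k[x_{i,j} | i : Fin r, 0 ≤ j ≤ n_i]` of `ℙ^{n_1} × ⋯ × ℙ^{n_r}`. -/
abbrev CoxRing (k : Type u) [Field k] {r : ℕ} (n : Fin r → ℕ) : Type u :=
  MvPolynomial (Σ i : Fin r, Fin (n i + 1)) k

/-- The degree `e_i ∈ ℤ^r` of the variable `x_{i,j}`. -/
def varDegree {r : ℕ} (n : Fin r → ℕ) (x : Σ i : Fin r, Fin (n i + 1)) : Fin r → ℤ :=
  Pi.single x.1 1

/-- The `ℤ^r`-grading of the Cox ring. -/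
noncomputable abbrev coxGrading (k : Type u) [Field k] {r : ℕ} (n : Fin r → ℕ) :
    (Fin r → ℤ) → Submodule k (CoxRing k n) :=
  MvPolynomial.weightedHomogeneousSubmodule k (varDegree n)

/-- The region `L_i(d) = ⋃_{|l| = i} (d - l + ℕ^r)`, with `l` running over `ℕ^r`. -/
def regionL {r : ℕ} (i : ℕ) (d : Fin r → ℤ) : Set (Fin r → ℤ) :=
  {b | ∃ l : Fin r → ℕ, ∑ t, l t = i ∧ d - (fun t => (l t : ℤ)) ≤ b}

/-- The region `Q_0(d) = d + ℕ^r`, and `Q_i(d) = L_{i-1}(d - 1)` for `i > 0`. -/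
def regionQ {r : ℕ} : ℕ → (Fin r → ℤ) → Set (Fin r → ℤ)
  | 0, d => {b | d ≤ b}
  | i + 1, d => regionL i (d - 1)

section Truncation

variable (k : Type u) [Field k] {r : ℕ} (n : Fin r → ℕ)
  {M : Type v} [AddCommGroup M] [Module (CoxRing k n) M]

/-- The degree of a monomial of the Cox ring is nonnegative. -/
theorem weight_varDegree_nonneg {r : ℕ} (n : Fin r → ℕ)
    (m : (Σ i : Fin r, Fin (n i + 1)) →₀ ℕ) :
    0 ≤ Finsupp.weight (varDegree n) m := by
  rw [Finsupp.weight_apply, Finsupp.sum]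
  refine Finset.sum_nonneg fun x _ => nsmul_nonneg ?_ _
  intro t
  simp only [varDegree, Pi.single_apply, Pi.zero_apply]
  split_ifs <;> simp

/-- The truncation `M_{≥ d} = ⊕_{d' ≥ d} M_{d'}` of a graded module `M`, as an `S`-submodule. -/
noncomputable def truncation (𝓜 : (Fin r → ℤ) → AddSubgroup M) [SetLike.GradedSMul (coxGrading k n) 𝓜]
    (d : Fin r → ℤ) : Submodule (CoxRing k n) M where
  __ := (⨆ e : {e : Fin r → ℤ // d ≤ e}, 𝓜 e : AddSubgroup M)
  smul_mem' := by
    intro s m hm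
    change s • m ∈ (⨆ e : {e : Fin r → ℤ // d ≤ e}, 𝓜 e : AddSubgroup M)
    change m ∈ (⨆ e : {e : Fin r → ℤ // d ≤ e}, 𝓜 e : AddSubgroup M) at hm
    refine AddSubgroup.iSup_induction (fun e : {e : Fin r → ℤ // d ≤ e} => 𝓜 e)
      (C := fun m => s • m ∈ (⨆ e : {e : Fin r → ℤ // d ≤ e}, 𝓜 e : AddSubgroup M))
      hm (fun e x hx => ?_) ?_ (fun x y hx hy => ?_)
    · induction s using MvPolynomial.induction_on' with
      | monomial p c =>
        have h1 : MvPolynomial.monomial p c ∈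
            coxGrading k n (Finsupp.weight (varDegree n) p) :=
          MvPolynomial.isWeightedHomogeneous_monomial _ _ _ rfl
        have h2 := SetLike.GradedSMul.smul_mem (B := 𝓜) h1 hx
        have h3 : d ≤ Finsupp.weight (varDegree n) p +ᵥ (e : Fin r → ℤ) := by
          rw [vadd_eq_add]
          exact e.2.trans (le_add_of_nonneg_left (weight_varDegree_nonneg n p))
        exact (le_iSup (fun e : {e : Fin r → ℤ // d ≤ e} => 𝓜 e) ⟨_, h3⟩) h2
      | add p q hp hq => rw [add_smul]; exact add_mem hp hq
    · rw [smul_zero]; exact zero_mem _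
    · rw [smul_add]; exact add_mem hx hy

/-- The grading that `M_{≥ d}` inherits from `M`. -/
noncomputable def truncationGrading (𝓜 : (Fin r → ℤ) → AddSubgroup M)
    [SetLike.GradedSMul (coxGrading k n) 𝓜] (d : Fin r → ℤ) :
    (Fin r → ℤ) → AddSubgroup (truncation k n 𝓜 d) :=
  fun e => (𝓜 e).comap (truncation k n 𝓜 d).subtype.toAddMonoidHom

end Truncation

/-- The degree `e` part of the graded free module `⊕_a S(-b_a)`, whose basis element with
index `a` has degree `b_a`: the coordinate at `a` of such an element lies in `S_{e - b_a}`. -/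
noncomputable def freeGrading (k : Type u) [Field k] {r : ℕ} (n : Fin r → ℕ) {ι : Type w}
    (b : ι → Fin r → ℤ) (e : Fin r → ℤ) : AddSubgroup (ι →₀ CoxRing k n) where
  carrier := {f | ∀ a, f a ∈ coxGrading k n (e - b a)}
  add_mem' hf hg a := add_mem (hf a) (hg a)
  zero_mem' a := zero_mem (coxGrading k n (e - b a))
  neg_mem' hf a := neg_mem (hf a)

/-- A `ℤ^r`-graded free resolution `⋯ → F_1 → F_0 → N → 0` of the graded module `N`, where
`F_j = ⊕_a S(-b_{j,a})` and all maps preserve degrees. Neither the ranks nor the length have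
to be finite, and the resolution need not be minimal. -/
structure GradedFreeResolution {k : Type u} [Field k] {r : ℕ} {n : Fin r → ℕ}
    {N : Type v} [AddCommGroup N] [Module (CoxRing k n) N]
    (𝒩 : (Fin r → ℤ) → AddSubgroup N) where
  /-- the index set of the chosen homogeneous basis of `F_j` -/
  index : ℕ → Type w
  /-- the degrees `b_{j,a}` of the basis elements of `F_j`; the twists are their negatives -/
  degree : ∀ j, index j → Fin r → ℤ
  /-- the differential `F_{j+1} → F_j` -/
  diff : ∀ j, (index (j + 1) →₀ CoxRing k n) →ₗ[CoxRing k n] (index j →₀ CoxRing k n)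
  /-- the augmentation `F_0 → N` -/
  aug : (index 0 →₀ CoxRing k n) →ₗ[CoxRing k n] N
  diff_mem : ∀ j e, ∀ f ∈ freeGrading k n (degree (j + 1)) e,
    diff j f ∈ freeGrading k n (degree j) e
  aug_mem : ∀ e, ∀ f ∈ freeGrading k n (degree 0) e, aug f ∈ 𝒩 e
  exact_diff : ∀ j, Function.Exact (diff (j + 1)) (diff j)
  exact_aug : Function.Exact (diff 0) aug
  aug_surjective : Function.Surjective aug

section Linear

variable {k : Type u} [Field k] {r : ℕ} {n : Fin r → ℕ}
  {N : Type v} [AddCommGroup N] [Module (CoxRing k n) N] {𝒩 : (Fin r → ℤ) → AddSubgroup N}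

/-- `F` is linear: `F_0` is generated in a single degree `d`, and the twists appearing in `F_j`
lie in `L_j(-d)`. -/
def GradedFreeResolution.IsLinear
    (F : GradedFreeResolution.{u, v, w} (k := k) (n := n) 𝒩) : Prop :=
  ∃ d : Fin r → ℤ, (∀ a, F.degree 0 a = d) ∧ ∀ j a, -F.degree j a ∈ regionL j (-d)

/-- `F` is quasilinear: `F_0` is generated in a single degree `d`, and the twists appearing in
`F_j` lie in `Q_j(-d)`. -/
def GradedFreeResolution.IsQuasilinear
    (F : GradedFreeResolution.{u, v, w} (k := k) (n := n) 𝒩) : Prop :=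
  ∃ d : Fin r → ℤ, (∀ a, F.degree 0 a = d) ∧ ∀ j a, -F.degree j a ∈ regionQ j (-d)

end Linear

section Has

variable (k : Type u) [Field k] {r : ℕ} (n : Fin r → ℕ)
  {N : Type v} [AddCommGroup N] [Module (CoxRing k n) N] (𝒩 : (Fin r → ℤ) → AddSubgroup N)

/-- The graded module `N` has a linear resolution. -/
def HasLinearResolution : Prop :=
  ∃ F : GradedFreeResolution.{u, v, max u v} (k := k) (n := n) 𝒩, F.IsLinear

/-- The graded module `N` has a quasilinear resolution. -/
def HasQuasilinearResolution : Prop :=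
  ∃ F : GradedFreeResolution.{u, v, max u v} (k := k) (n := n) 𝒩, F.IsQuasilinear

end Has

end Multigraded

/-! Let F be the given resolution of M_{≥d}, with F_0 generated in degree e, and put c = d' ⊔ e.
Being a quotient of F_0, the module M_{≥d} lives in degrees ≥ e, so M_{≥d'} = (M_{≥d})_{≥c}.
Truncation is exact, hence F_{≥c} is an exact complex over this module, and its terms are direct
sums of modules S(-b)_{≥c}.

The crux is that S(-b)_{≥c} has a linear resolution generated in the single degree b ⊔ c
(`resolvable_trunc_freeOne`). The induction runs over all quotients of S by sets V of variables,
through the sequences 0 → (S/V)(-b - deg x) → (S/V)(-b) → (S/(V,x))(-b) → 0 of `ses_varQuot`. If c ≤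
b, truncation changes nothing and mapping cones build the Koszul resolution. If b_i < c_i and V
omits a variable of block i, the middle term is an extension of two simpler cases with the same b ⊔
c. If V contains all of block i, the truncation is zero.

`Resolvable.trunc` assembles these resolutions of the terms of F_{≥c} into one of M_{≥d'}. A
generator of F_j of degree b contributes to homological degree j + i generators of degree b' = (b ⊔
c) + l with |l| = i. Since e ≤ c, a bound b ≤ e + λ becomes b' ≤ c + λ + l, which is what both
regions ask for; in the quasilinear case with j = 0 one unit of l is absorbed by the shift by **1**.
-/

namespace Multigraded

universe u v

/-! ### Graded modules and degree preserving maps -/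

/-- A `ℤ^r`-graded module over the Cox ring, presented by the projections onto its graded
pieces. -/
structure GrMod (k : Type u) [Field k] {r : ℕ} (n : Fin r → ℕ) where
  /-- the underlying module -/
  carrier : Type (max u v)
  [grp : AddCommGroup carrier]
  [mod : Module (CoxRing k n) carrier]
  /-- the projection onto the degree `e` part -/
  proj : (Fin r → ℤ) → carrier →+ carrier
  proj_proj : ∀ e m, proj e (proj e m) = proj e m
  proj_proj_ne : ∀ e e' m, e ≠ e' → proj e (proj e' m) = 0
  exists_sum : ∀ m, ∃ s : Finset (Fin r → ℤ), ∑ e ∈ s, proj e m = m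
  proj_smul : ∀ a e, ∀ s ∈ coxGrading k n a, ∀ m, proj (a + e) (s • m) = s • proj e m

attribute [instance] GrMod.grp GrMod.mod

instance (k : Type u) [Field k] {r : ℕ} (n : Fin r → ℕ) :
    CoeSort (GrMod.{u, v} k n) (Type (max u v)) := ⟨GrMod.carrier⟩

section

variable {k : Type u} [Field k] {r : ℕ} {n : Fin r → ℕ}

namespace GrMod

theorem ext_proj (N : GrMod.{u, v} k n) {x y : N} (h : ∀ e, N.proj e x = N.proj e y) : x = y := by
  rw [← sub_eq_zero]
  obtain ⟨s, hs⟩ := N.exists_sum (x - y)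
  rw [← hs]
  exact Finset.sum_eq_zero fun e _ => by rw [map_sub, h, sub_self]

theorem exists_sum_superset (N : GrMod.{u, v} k n) (m : N) :
    ∃ s : Finset (Fin r → ℤ), (∀ e ∉ s, N.proj e m = 0) ∧ ∑ e ∈ s, N.proj e m = m := by
  obtain ⟨s, hs⟩ := N.exists_sum m
  refine ⟨s, fun e he => ?_, hs⟩
  rw [← hs, map_sum]
  exact Finset.sum_eq_zero fun e' he' => N.proj_proj_ne _ _ _ (fun h => he (h ▸ he'))

/-- The elements of degree `e`. -/
def piece (N : GrMod.{u, v} k n) (e : Fin r → ℤ) : AddSubgroup N where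
  carrier := {m | N.proj e m = m}
  add_mem' {a b} ha hb := by
    rw [Set.mem_ofPred_eq] at *
    rw [map_add, ha, hb]
  zero_mem' := map_zero _
  neg_mem' {a} ha := by
    rw [Set.mem_ofPred_eq] at *
    rw [map_neg, ha]

theorem mem_piece {N : GrMod.{u, v} k n} {e : Fin r → ℤ} {m : N} :
    m ∈ N.piece e ↔ N.proj e m = m := Iff.rfl

theorem proj_mem_piece (N : GrMod.{u, v} k n) (e : Fin r → ℤ) (m : N) : N.proj e m ∈ N.piece e :=
  N.proj_proj e m

theorem proj_of_mem_piece_ne {N : GrMod.{u, v} k n} {e e' : Fin r → ℤ} {m : N}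
    (hm : m ∈ N.piece e) (h : e' ≠ e) : N.proj e' m = 0 := by
  rw [← mem_piece.1 hm]
  exact N.proj_proj_ne _ _ _ h

theorem smul_mem_piece (N : GrMod.{u, v} k n) {a e : Fin r → ℤ} {s : CoxRing k n}
    (hs : s ∈ coxGrading k n a) {m : N} (hm : m ∈ N.piece e) : s • m ∈ N.piece (a + e) := by
  rw [mem_piece, N.proj_smul a e s hs, mem_piece.1 hm]

end GrMod

/-- Degree preserving linear maps. -/
def IsGr (N N' : GrMod.{u, v} k n) (f : N →ₗ[CoxRing k n] N') : Prop :=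
  ∀ e m, f (N.proj e m) = N'.proj e (f m)

theorem IsGr.comp {N N' N'' : GrMod.{u, v} k n} {g : N' →ₗ[CoxRing k n] N''}
    {f : N →ₗ[CoxRing k n] N'} (hg : IsGr N' N'' g) (hf : IsGr N N' f) :
    IsGr N N'' (g ∘ₗ f) := fun e m => by
  rw [LinearMap.comp_apply, hf, hg, LinearMap.comp_apply]

theorem IsGr.of_mem_piece {N N' : GrMod.{u, v} k n} {f : N →ₗ[CoxRing k n] N'}
    (h : ∀ e, ∀ m ∈ N.piece e, f m ∈ N'.piece e) : IsGr N N' f := fun e m => by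
  obtain ⟨s, hs, hm⟩ := N.exists_sum_superset m
  have key : ∀ e', N'.proj e (f (N.proj e' m)) = if e = e' then f (N.proj e' m) else 0 := by
    intro e'
    split_ifs with hee
    · subst hee
      exact h _ _ (N.proj_mem_piece e m)
    · exact GrMod.proj_of_mem_piece_ne (h _ _ (N.proj_mem_piece e' m)) hee
  conv_rhs => rw [← hm, map_sum, map_sum]
  simp_rw [key]
  rw [Finset.sum_ite_eq]
  split_ifs with he
  · rfl
  · rw [hs e he, map_zero]

theorem IsGr.map_mem_piece {N N' : GrMod.{u, v} k n} {f : N →ₗ[CoxRing k n] N'}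
    (hf : IsGr N N' f) {e : Fin r → ℤ} {m : N} (hm : m ∈ N.piece e) : f m ∈ N'.piece e := by
  rw [GrMod.mem_piece, ← hf, GrMod.mem_piece.1 hm]

/-- A submodule stable under the projections is graded. -/
noncomputable def GrMod.sub (N : GrMod.{u, v} k n) (U : Submodule (CoxRing k n) N)
    (hU : ∀ e, ∀ m ∈ U, N.proj e m ∈ U) : GrMod.{u, v} k n where
  carrier := U
  proj e := ((N.proj e).comp U.subtype.toAddMonoidHom).codRestrict U fun m => hU e m m.2
  proj_proj e m := Subtype.ext (N.proj_proj e m)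
  proj_proj_ne e e' m h := Subtype.ext (N.proj_proj_ne e e' m h)
  exists_sum m := by
    obtain ⟨s, hs⟩ := N.exists_sum m
    refine ⟨s, Subtype.ext ?_⟩
    rw [AddSubmonoidClass.coe_finsetSum]
    exact hs
  proj_smul a e s hs m := Subtype.ext (N.proj_smul a e s hs m)

/-- The inclusion of a graded submodule. -/
noncomputable def GrMod.incl (N : GrMod.{u, v} k n) (U : Submodule (CoxRing k n) N)
    (hU : ∀ e, ∀ m ∈ U, N.proj e m ∈ U) : N.sub U hU →ₗ[CoxRing k n] N := U.subtype

theorem GrMod.isGr_incl (N : GrMod.{u, v} k n) (U : Submodule (CoxRing k n) N)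
    (hU : ∀ e, ∀ m ∈ U, N.proj e m ∈ U) : IsGr _ _ (N.incl U hU) := fun _ _ => rfl

theorem GrMod.incl_injective (N : GrMod.{u, v} k n) (U : Submodule (CoxRing k n) N)
    (hU : ∀ e, ∀ m ∈ U, N.proj e m ∈ U) : Function.Injective (N.incl U hU) :=
  Subtype.val_injective

/-- The quotient by a graded submodule. -/
noncomputable def GrMod.quot (N : GrMod.{u, v} k n) (U : Submodule (CoxRing k n) N)
    (hU : ∀ e, ∀ m ∈ U, N.proj e m ∈ U) : GrMod.{u, v} k n where
  carrier := N ⧸ U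
  proj e := QuotientAddGroup.map U.toAddSubgroup U.toAddSubgroup (N.proj e) fun m hm => hU e m hm
  proj_proj e m := by
    obtain ⟨m, rfl⟩ := U.mkQ_surjective m
    exact congrArg U.mkQ (N.proj_proj e m)
  proj_proj_ne e e' m h := by
    obtain ⟨m, rfl⟩ := U.mkQ_surjective m
    exact (congrArg U.mkQ (N.proj_proj_ne e e' m h)).trans (map_zero _)
  exists_sum m := by
    obtain ⟨m, rfl⟩ := U.mkQ_surjective m
    obtain ⟨s, hs⟩ := N.exists_sum m
    refine ⟨s, ?_⟩
    conv_rhs => rw [← hs, map_sum]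
    rfl
  proj_smul a e s hs m := by
    obtain ⟨m, rfl⟩ := U.mkQ_surjective m
    exact congrArg U.mkQ (N.proj_smul a e s hs m)

/-! ### Graded free modules and lifting of maps -/

theorem weightedHomogeneousComponent_mul {a : Fin r → ℤ} {s : CoxRing k n}
    (hs : s ∈ coxGrading k n a) (e : Fin r → ℤ) (p : CoxRing k n) :
    MvPolynomial.weightedHomogeneousComponent (varDegree n) (a + e) (s * p) =
      s * MvPolynomial.weightedHomogeneousComponent (varDegree n) e p := by
  classical
  induction p using MvPolynomial.induction_on' with
  | monomial m c =>
    have h1 : (MvPolynomial.monomial m c).IsWeightedHomogeneous (varDegree n)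
        (Finsupp.weight (varDegree n) m) :=
      MvPolynomial.isWeightedHomogeneous_monomial _ _ _ rfl
    have h2 := MvPolynomial.IsWeightedHomogeneous.mul hs h1
    rw [MvPolynomial.weightedHomogeneousComponent_of_mem h2,
      MvPolynomial.weightedHomogeneousComponent_of_mem h1]
    simp only [add_right_inj]
    split_ifs <;> simp
  | add p q hp hq => rw [mul_add, map_add, map_add, hp, hq, mul_add]

/-- The graded free module with basis elements of degrees `b a`. -/
noncomputable def free {ι : Type (max u v)} (b : ι → Fin r → ℤ) : GrMod.{u, v} k n where
  carrier := ι →₀ CoxRing k n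
  proj e :=
    { toFun := fun f => Finsupp.onFinset f.support
        (fun a => MvPolynomial.weightedHomogeneousComponent (varDegree n) (e - b a) (f a))
        (fun a ha => by
          rw [Finsupp.mem_support_iff]
          rintro h
          exact ha (by rw [h, map_zero]))
      map_zero' := by ext1 a; simp
      map_add' := fun f g => by ext1 a; simp }
  proj_proj e m := by
    ext1 a
    exact (MvPolynomial.weightedHomogeneousComponent_isWeightedHomogeneous
      (w := varDegree n) (e - b a) (m a)).weightedHomogeneousComponent_same
  proj_proj_ne e e' m h := by
    ext1 a
    exact (MvPolynomial.weightedHomogeneousComponent_isWeightedHomogeneous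
      (w := varDegree n) (e' - b a) (m a)).weightedHomogeneousComponent_ne _ (by simpa using h)
  exists_sum m := by
    classical
    refine ⟨m.support.biUnion fun a => (m a).support.image
      fun d => Finsupp.weight (varDegree n) d + b a, ?_⟩
    ext a d
    rw [Finsupp.finsetSum_apply, MvPolynomial.coeff_sum]
    simp only [AddMonoidHom.coe_mk, ZeroHom.coe_mk, Finsupp.onFinset_apply,
      MvPolynomial.coeff_weightedHomogeneousComponent, eq_sub_iff_add_eq]
    rw [Finset.sum_ite_eq]
    split_ifs with h
    · rfl
    · by_contra hne
      refine h (Finset.mem_biUnion.2 ⟨a, ?_, Finset.mem_image.2 ⟨d, ?_, rfl⟩⟩)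
      · rw [Finsupp.mem_support_iff]
        rintro h0
        rw [h0] at hne
        simp at hne
      · rw [MvPolynomial.mem_support_iff]
        exact fun h0 => hne h0.symm
  proj_smul a e s hs m := by
    ext1 i
    change MvPolynomial.weightedHomogeneousComponent (varDegree n) (a + e - b i) (s * m i) =
      s * MvPolynomial.weightedHomogeneousComponent (varDegree n) (e - b i) (m i)
    rw [add_sub_assoc, weightedHomogeneousComponent_mul hs]

/-- The identification of the underlying module of `free b`. -/
noncomputable def toFree {ι : Type (max u v)} (b : ι → Fin r → ℤ) :
    (ι →₀ CoxRing k n) ≃ₗ[CoxRing k n] free.{u, v} (k := k) (n := n) b :=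
  LinearEquiv.refl _ _

theorem free_proj_apply {ι : Type (max u v)} (b : ι → Fin r → ℤ) (e : Fin r → ℤ)
    (f : free.{u, v} (k := k) (n := n) b) (a : ι) :
    (toFree b).symm ((free.{u, v} (k := k) (n := n) b).proj e f) a =
      MvPolynomial.weightedHomogeneousComponent (varDegree n) (e - b a)
        ((toFree b).symm f a) := rfl

theorem mem_free_piece {ι : Type (max u v)} (b : ι → Fin r → ℤ) (e : Fin r → ℤ)
    (f : free.{u, v} (k := k) (n := n) b) :
    f ∈ (free.{u, v} (k := k) (n := n) b).piece e ↔
      (toFree b).symm f ∈ freeGrading k n b e := by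
  classical
  constructor
  · intro h a
    rw [← GrMod.mem_piece.1 h, free_proj_apply]
    exact MvPolynomial.weightedHomogeneousComponent_isWeightedHomogeneous _ _
  · intro h
    rw [GrMod.mem_piece]
    refine (toFree b).symm.injective (Finsupp.ext fun a => ?_)
    rw [free_proj_apply]
    exact MvPolynomial.IsWeightedHomogeneous.weightedHomogeneousComponent_same (h a)

theorem single_mem_piece {ι : Type (max u v)} (b : ι → Fin r → ℤ) (a : ι) {e : Fin r → ℤ}
    {s : CoxRing k n} (hs : s ∈ coxGrading k n (e - b a)) :
    toFree b (Finsupp.single a s) ∈ (free.{u, v} (k := k) (n := n) b).piece e := by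
  classical
  rw [mem_free_piece, LinearEquiv.symm_apply_apply]
  intro a'
  rw [Finsupp.single_apply]
  split_ifs with h
  · exact h ▸ hs
  · exact zero_mem (coxGrading k n _)

theorem basis_mem_piece {ι : Type (max u v)} (b : ι → Fin r → ℤ) (a : ι) :
    toFree b (Finsupp.single a 1) ∈ (free.{u, v} (k := k) (n := n) b).piece (b a) := by
  refine single_mem_piece b a ?_
  rw [sub_self]
  exact MvPolynomial.isWeightedHomogeneous_one _ _

/-- The map from a free module given by the images of the basis. -/
noncomputable def freeLift {ι : Type (max u v)} (b : ι → Fin r → ℤ) (N : GrMod.{u, v} k n)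
    (x : ι → N) : free.{u, v} (k := k) (n := n) b →ₗ[CoxRing k n] N :=
  Finsupp.linearCombination (CoxRing k n) x ∘ₗ (toFree b).symm.toLinearMap

theorem freeLift_single {ι : Type (max u v)} (b : ι → Fin r → ℤ) (N : GrMod.{u, v} k n)
    (x : ι → N) (a : ι) (s : CoxRing k n) :
    freeLift b N x (toFree b (Finsupp.single a s)) = s • x a :=
  Finsupp.linearCombination_single _ _ _

theorem isGr_freeLift {ι : Type (max u v)} (b : ι → Fin r → ℤ) (N : GrMod.{u, v} k n)
    (x : ι → N) (hx : ∀ a, x a ∈ N.piece (b a)) : IsGr _ _ (freeLift b N x) := by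
  refine IsGr.of_mem_piece fun e m hm => ?_
  rw [mem_free_piece] at hm
  change Finsupp.sum _ _ ∈ _
  refine AddSubgroup.sum_mem _ fun a _ => ?_
  have := N.smul_mem_piece (hm a) (hx a)
  rwa [sub_add_cancel] at this

theorem free_hom_ext {ι : Type (max u v)} {b : ι → Fin r → ℤ} {X : Type*} [AddCommGroup X]
    [Module (CoxRing k n) X]
    {f g : free.{u, v} (k := k) (n := n) b →ₗ[CoxRing k n] X}
    (h : ∀ a, f (toFree b (Finsupp.single a 1)) = g (toFree b (Finsupp.single a 1))) : f = g :=
  Finsupp.lhom_ext' fun a => LinearMap.ext_ring (h a)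

theorem exists_lift_of_surjective {ι : Type (max u v)} (b : ι → Fin r → ℤ)
    {N N' : GrMod.{u, v} k n}
    {g : N →ₗ[CoxRing k n] N'} (hg : IsGr _ _ g) (hs : Function.Surjective g)
    {p : free.{u, v} (k := k) (n := n) b →ₗ[CoxRing k n] N'} (hp : IsGr _ _ p) :
    ∃ q : free.{u, v} (k := k) (n := n) b →ₗ[CoxRing k n] N, IsGr _ _ q ∧ ∀ x, g (q x) = p x := by
  choose y hy using fun a => hs (p (toFree b (Finsupp.single a 1)))
  -- An arbitrary preimage need not be homogeneous; its component of degree `b a` is, and has the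
  -- same image because `g` commutes with projections.
  refine ⟨freeLift b N fun a => N.proj (b a) (y a), isGr_freeLift _ _ _ fun a =>
    N.proj_mem_piece _ _, fun x => ?_⟩
  rw [← LinearMap.comp_apply]
  refine LinearMap.congr_fun (free_hom_ext fun a => ?_) x
  rw [LinearMap.comp_apply, freeLift_single, one_smul, hg, hy]
  exact hp.map_mem_piece (basis_mem_piece b a)

/-- The universal property through which kernels and truncations are handled below: each is known
only by its injection into an ambient module. -/
theorem exists_lift_of_injective {K F E : GrMod.{u, v} k n} {i : K →ₗ[CoxRing k n] F}
    (hi : IsGr _ _ i) (hinj : Function.Injective i) {g : E →ₗ[CoxRing k n] F} (hg : IsGr _ _ g)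
    (h : ∀ x, ∃ y, i y = g x) :
    ∃ q : E →ₗ[CoxRing k n] K, IsGr _ _ q ∧ ∀ x, i (q x) = g x := by
  choose q hq using h
  refine ⟨{ toFun := q, map_add' := fun x y => hinj ?_, map_smul' := fun s x => hinj ?_ },
    fun e m => hinj ?_, hq⟩
  · rw [map_add, hq, hq, hq, map_add]
  · rw [RingHom.id_apply, map_smul, hq, hq, map_smul]
  · change i (q _) = i (K.proj e (q m))
    rw [hi, hq, hq, hg]

/-! ### Short exact sequences, syzygies and the horseshoe lemma -/

/-- `0 → N₁ → N₂ → N₃ → 0` is exact for some degree preserving maps. -/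
def SES (N₁ N₂ N₃ : GrMod.{u, v} k n) : Prop :=
  ∃ (f : N₁ →ₗ[CoxRing k n] N₂) (g : N₂ →ₗ[CoxRing k n] N₃), IsGr _ _ f ∧ IsGr _ _ g ∧
    Function.Injective f ∧ Function.Exact f g ∧ Function.Surjective g

/-- The kernel of a degree preserving map. -/
noncomputable def grKer {N N' : GrMod.{u, v} k n} (g : N →ₗ[CoxRing k n] N') (hg : IsGr _ _ g) :
    GrMod.{u, v} k n :=
  N.sub (LinearMap.ker g) fun e m hm => by
    rw [LinearMap.mem_ker] at *
    rw [hg, hm, map_zero]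

theorem exists_ker {N N' : GrMod.{u, v} k n} (g : N →ₗ[CoxRing k n] N') (hg : IsGr _ _ g) :
    ∃ (K : GrMod.{u, v} k n) (i : K →ₗ[CoxRing k n] N), IsGr _ _ i ∧ Function.Injective i ∧
      Function.Exact i g := by
  refine ⟨grKer g hg, GrMod.incl _ _ _, GrMod.isGr_incl _ _ _, GrMod.incl_injective _ _ _,
    fun y => ⟨fun hy => ⟨⟨y, hy⟩, rfl⟩, ?_⟩⟩
  rintro ⟨x, rfl⟩
  exact x.2

/-- `E` is the kernel of the composite G → B → C; the map G → B sends it onto K, with kernel K'. -/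
theorem SES.comp {K' G B K C : GrMod.{u, v} k n} (h : SES K' G B) (h' : SES K B C) :
    ∃ E, SES E G C ∧ SES K' E K := by
  obtain ⟨i, p, hi, hp, iinj, iex, psurj⟩ := h
  obtain ⟨f, g, hf, hg, finj, fex, gsurj⟩ := h'
  obtain ⟨E, j, hj, jinj, jex⟩ := exists_ker (g ∘ₗ p) (hg.comp hp)
  refine ⟨E, ⟨j, g ∘ₗ p, hj, hg.comp hp, jinj, jex, gsurj.comp psurj⟩, ?_⟩
  obtain ⟨a, ha, hja⟩ := exists_lift_of_injective hj jinj hi fun x => (jex (i x)).1 (by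
    rw [LinearMap.comp_apply, (iex (i x)).2 ⟨x, rfl⟩, map_zero])
  obtain ⟨c, hc, hfc⟩ := exists_lift_of_injective hf finj (hp.comp hj) fun x => (fex _).1 (by
    exact (jex (j x)).2 ⟨x, rfl⟩)
  refine ⟨a, c, ha, hc, fun x y hxy => iinj ?_, fun x => ⟨fun hx => ?_, ?_⟩, fun y => ?_⟩
  · rw [← hja, hxy, hja]
  · have h0 : p (j x) = 0 := by rw [← LinearMap.comp_apply, ← hfc, hx, map_zero]
    obtain ⟨z, hz⟩ := (iex _).1 h0
    exact ⟨z, jinj ((hja z).trans hz)⟩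
  · rintro ⟨z, rfl⟩
    apply finj
    rw [hfc, LinearMap.comp_apply, hja, (iex (i z)).2 ⟨z, rfl⟩, map_zero]
  · obtain ⟨z, hz⟩ := psurj (f y)
    obtain ⟨w, hw⟩ := (jex z).1 (by
      rw [LinearMap.comp_apply, hz]
      exact (fex _).2 ⟨y, rfl⟩)
    refine ⟨w, finj ?_⟩
    rw [hfc, LinearMap.comp_apply, hw, hz]

/-- `K` is the kernel of a surjection onto `N` from a free module with generators in degrees
belonging to `D`. -/
def Step (D : Set (Fin r → ℤ)) (N K : GrMod.{u, v} k n) : Prop :=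
  ∃ (ι : Type (max u v)) (b : ι → Fin r → ℤ), (∀ a, b a ∈ D) ∧ SES K (free b) N

theorem Step.mono {D D' : Set (Fin r → ℤ)} (hD : D ⊆ D') {N K : GrMod.{u, v} k n}
    (h : Step D N K) : Step D' N K := by
  obtain ⟨ι, b, hb, h⟩ := h
  exact ⟨ι, b, fun a => hD (hb a), h⟩

theorem ses_free_sum {ι κ : Type (max u v)} (b : ι → Fin r → ℤ) (c : κ → Fin r → ℤ) :
    ∃ (i : free.{u, v} (k := k) (n := n) b →ₗ[CoxRing k n]
          free.{u, v} (k := k) (n := n) (Sum.elim b c))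
      (q : free.{u, v} (k := k) (n := n) (Sum.elim b c) →ₗ[CoxRing k n]
          free.{u, v} (k := k) (n := n) c),
      IsGr _ _ q ∧ Function.Injective i ∧ Function.Exact i q ∧ Function.Surjective q ∧
      (∀ a, i (toFree b (Finsupp.single a 1)) = toFree _ (Finsupp.single (Sum.inl a) 1)) ∧
      (∀ a, q (toFree _ (Finsupp.single (Sum.inl a) 1)) = 0) ∧
      (∀ a, q (toFree _ (Finsupp.single (Sum.inr a) 1)) = toFree c (Finsupp.single a 1)) ∧
      IsGr _ _ i := by
  classical
  let e := Finsupp.sumFinsuppLEquivProdFinsupp (CoxRing k n) (α := ι) (β := κ) (M := CoxRing k n)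
  refine ⟨(toFree _).toLinearMap ∘ₗ e.symm.toLinearMap ∘ₗ LinearMap.inl _ _ _ ∘ₗ
    (toFree b).symm.toLinearMap, (toFree c).toLinearMap ∘ₗ LinearMap.snd _ _ _ ∘ₗ e.toLinearMap ∘ₗ
    (toFree _).symm.toLinearMap, ?_, ?_, ?_, ?_, ?_, ?_, ?_, ?_⟩
  · refine IsGr.of_mem_piece fun d m hm => ?_
    rw [mem_free_piece] at hm ⊢
    exact fun a => hm (Sum.inr a)
  · intro x y hxy
    simpa using hxy
  · intro x
    constructor
    · intro hx
      refine ⟨toFree b (e ((toFree _).symm x)).1, ?_⟩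
      apply (toFree _).symm.injective
      apply e.injective
      have h2 : (e ((toFree _).symm x)).2 = 0 := by simpa using hx
      refine Prod.ext ?_ ?_
      · simp
      · simpa using h2.symm
    · rintro ⟨y, rfl⟩
      simp
  · intro y
    refine ⟨toFree _ (e.symm (0, (toFree c).symm y)), ?_⟩
    simp
  · intro a
    apply (toFree _).symm.injective
    refine Finsupp.ext fun t => ?_
    rcases t with t | t <;> simp [e, Finsupp.single_apply]
  · intro a
    apply (toFree _).symm.injective
    refine Finsupp.ext fun t => ?_
    simp [e]
  · intro a
    apply (toFree _).symm.injective
    refine Finsupp.ext fun t => ?_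
    simp [e, Finsupp.single_apply]
  · refine IsGr.of_mem_piece fun d m hm => ?_
    rw [mem_free_piece] at hm ⊢
    rintro (a | a)
    · exact hm a
    · exact zero_mem (coxGrading k n _)

/-- The cover of `N` lifts to `E` because its source is free. Together with the cover of `L` it
covers `E`, and the snake argument makes the three kernels exact. -/
theorem Step.horseshoe {D : Set (Fin r → ℤ)} {L E N L' N' : GrMod.{u, v} k n} (h : SES L E N)
    (hL : Step D L L') (hN : Step D N N') : ∃ E', Step D E E' ∧ SES L' E' N' := by
  obtain ⟨f, g, hf, hg, finj, fex, gsurj⟩ := h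
  obtain ⟨ι, b, hb, i₁, p₁, hi₁, hp₁, inj₁, ex₁, surj₁⟩ := hL
  obtain ⟨κ, c, hc, i₃, p₃, hi₃, hp₃, inj₃, ex₃, surj₃⟩ := hN
  obtain ⟨i, q, hq, iinj, iex, qsurj, hisingle, hqinl, hqinr, hi⟩ :=
    ses_free_sum.{u, v} (k := k) (n := n) b c
  obtain ⟨s, hs, hgs⟩ := exists_lift_of_surjective c hg gsurj hp₃
  let p := freeLift (Sum.elim b c) E (Sum.elim (fun a => f (p₁ (toFree b (Finsupp.single a 1))))
    fun a => s (toFree c (Finsupp.single a 1)))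
  have hp : IsGr _ _ p := isGr_freeLift _ _ _ (by
    rintro (a | a)
    · exact (hf.comp hp₁).map_mem_piece (basis_mem_piece b a)
    · exact hs.map_mem_piece (basis_mem_piece c a))
  have hpi : ∀ x, p (i x) = f (p₁ x) := LinearMap.congr_fun (f := p ∘ₗ i) (g := f ∘ₗ p₁)
    (free_hom_ext fun a => by
      rw [LinearMap.comp_apply, hisingle, freeLift_single, one_smul]
      rfl)
  have hgp : ∀ x, g (p x) = p₃ (q x) := LinearMap.congr_fun (f := g ∘ₗ p) (g := p₃ ∘ₗ q)
    (free_hom_ext fun a => by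
      rcases a with a | a
      · rw [LinearMap.comp_apply, LinearMap.comp_apply, hqinl, freeLift_single, one_smul, map_zero]
        exact (fex _).2 ⟨_, rfl⟩
      · rw [LinearMap.comp_apply, LinearMap.comp_apply, hqinr, freeLift_single, one_smul]
        exact hgs _)
  have psurj : Function.Surjective p := by
    intro y
    obtain ⟨z, hz⟩ := surj₃ (g y)
    obtain ⟨w, rfl⟩ := qsurj z
    obtain ⟨l, hl⟩ := (fex (y - p w)).1 (by rw [map_sub, hgp, hz, sub_self])
    obtain ⟨m, rfl⟩ := surj₁ l
    refine ⟨i m + w, ?_⟩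
    rw [map_add, hpi, hl, sub_add_cancel]
  obtain ⟨E', j, hj, jinj, jex⟩ := exists_ker p hp
  refine ⟨E', ⟨ι ⊕ κ, Sum.elim b c, ?_, j, p, hj, hp, jinj, jex, psurj⟩, ?_⟩
  · rintro (a | a)
    exacts [hb a, hc a]
  obtain ⟨α, hα, hjα⟩ := exists_lift_of_injective hj jinj (hi.comp hi₁) fun x => (jex _).1 (by
    rw [LinearMap.comp_apply, hpi, (ex₁ (i₁ x)).2 ⟨x, rfl⟩, map_zero])
  obtain ⟨β, hβ, hiβ⟩ := exists_lift_of_injective hi₃ inj₃ (hq.comp hj) fun x => (ex₃ _).1 (by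
    rw [LinearMap.comp_apply, ← hgp, (jex (j x)).2 ⟨x, rfl⟩, map_zero])
  refine ⟨α, β, hα, hβ, fun x y hxy => inj₁ (iinj ?_), fun x => ⟨fun hx => ?_, ?_⟩, fun y => ?_⟩
  · have := hjα x
    rw [hxy, hjα] at this
    exact this.symm
  · have h0 : q (j x) = 0 := by rw [← LinearMap.comp_apply, ← hiβ, hx, map_zero]
    obtain ⟨z, hz⟩ := (iex _).1 h0
    have h1 : p₁ z = 0 := by
      apply finj
      rw [← hpi, hz, map_zero, (jex (j x)).2 ⟨x, rfl⟩]
    obtain ⟨w, rfl⟩ := (ex₁ _).1 h1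
    exact ⟨w, jinj ((hjα w).trans hz)⟩
  · rintro ⟨z, rfl⟩
    apply inj₃
    rw [hiβ, LinearMap.comp_apply, hjα, map_zero]
    exact (iex _).2 ⟨_, rfl⟩
  · obtain ⟨z, hz⟩ := qsurj (i₃ y)
    obtain ⟨l, hl⟩ := (fex (p z)).1 (by rw [hgp, hz, (ex₃ (i₃ y)).2 ⟨y, rfl⟩])
    obtain ⟨m, rfl⟩ := surj₁ l
    obtain ⟨w, hw⟩ := (jex (z - i m)).1 (by rw [map_sub, hpi, hl, sub_self])
    refine ⟨w, inj₃ ?_⟩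
    rw [hiβ, LinearMap.comp_apply, hw, map_sub, hz, (iex (i m)).2 ⟨m, rfl⟩, sub_zero]

/-! ### Resolvability, extensions and mapping cones -/

/-- `N` has a graded free resolution whose `j`-th term is generated in degrees belonging to
`A j`; the predicate `P j` describes the `j`-th syzygy modules. -/
def Resolvable (A : ℕ → Set (Fin r → ℤ)) (N : GrMod.{u, v} k n) : Prop :=
  ∃ P : ℕ → GrMod.{u, v} k n → Prop, P 0 N ∧
    ∀ j N, P j N → ∃ K, Step (A j) N K ∧ P (j + 1) K

namespace Resolvable

variable {A B : ℕ → Set (Fin r → ℤ)}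

theorem mono (hAB : ∀ j, A j ⊆ B j) {N : GrMod.{u, v} k n} (h : Resolvable A N) :
    Resolvable B N := by
  obtain ⟨P, h0, h⟩ := h
  refine ⟨P, h0, fun j N hN => ?_⟩
  obtain ⟨K, hK, hP⟩ := h j N hN
  exact ⟨K, hK.mono (hAB j), hP⟩

theorem exists_step {N : GrMod.{u, v} k n} (h : Resolvable A N) :
    ∃ K, Step (A 0) N K ∧ Resolvable (fun j => A (j + 1)) K := by
  obtain ⟨P, h0, h⟩ := h
  obtain ⟨K, hK, hP⟩ := h 0 N h0
  exact ⟨K, hK, fun j => P (j + 1), hP, fun j => h (j + 1)⟩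

theorem of_step {N K : GrMod.{u, v} k n} (h : Step (A 0) N K)
    (hK : Resolvable (fun j => A (j + 1)) K) : Resolvable A N := by
  obtain ⟨P, h0, hP⟩ := hK
  refine ⟨fun j X => (j = 0 ∧ X = N) ∨ ∃ i, j = i + 1 ∧ P i X, Or.inl ⟨rfl, rfl⟩, ?_⟩
  rintro j X (⟨rfl, rfl⟩ | ⟨i, rfl, hX⟩)
  · exact ⟨K, h, Or.inr ⟨0, rfl, h0⟩⟩
  · obtain ⟨Y, hY, hPY⟩ := hP i X hX
    exact ⟨Y, hY, Or.inr ⟨_, rfl, hPY⟩⟩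

theorem of_subsingleton (N : GrMod.{u, v} k n) [Subsingleton N] : Resolvable A N := by
  refine ⟨fun _ X => Subsingleton X, inferInstance, fun j X hX => ?_⟩
  let b : PEmpty.{max u v + 1} → Fin r → ℤ := fun a => a.elim
  have hsub : Subsingleton (free.{u, v} (k := k) (n := n) b) :=
    inferInstanceAs (Subsingleton (PEmpty →₀ CoxRing k n))
  exact ⟨free b, ⟨PEmpty, b, fun a => a.elim, LinearMap.id, 0, fun _ _ => rfl,
    fun _ _ => (map_zero _).symm, fun _ _ h => h,
    fun x => ⟨fun _ => ⟨x, rfl⟩, fun _ => rfl⟩, fun y => ⟨0, Subsingleton.elim _ _⟩⟩, hsub⟩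

theorem ext {N₁ N₂ N₃ : GrMod.{u, v} k n} (h : SES N₁ N₂ N₃) (h₁ : Resolvable A N₁)
    (h₃ : Resolvable A N₃) : Resolvable A N₂ := by
  obtain ⟨P, hP, hP'⟩ := h₁
  obtain ⟨Q, hQ, hQ'⟩ := h₃
  -- The property of being such an extension passes from one syzygy to the next by the horseshoe
  -- lemma.
  refine ⟨fun j X => ∃ X₁ X₃, SES X₁ X X₃ ∧ P j X₁ ∧ Q j X₃, ⟨_, _, h, hP, hQ⟩, ?_⟩
  rintro j X ⟨X₁, X₃, hX, h₁, h₃⟩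
  obtain ⟨Y₁, hs₁, hY₁⟩ := hP' j _ h₁
  obtain ⟨Y₃, hs₃, hY₃⟩ := hQ' j _ h₃
  obtain ⟨Y, hs, hY⟩ := hs₁.horseshoe hX hs₃
  exact ⟨Y, hs, Y₁, Y₃, hY, hY₁, hY₃⟩

/-- The first syzygy of `N₃`, taken along the cover of `N₂`, is an extension of `N₁` by the first
syzygy of `N₂`. Both are resolved in the shifted degrees, so `ext` applies. -/
theorem cone {N₁ N₂ N₃ : GrMod.{u, v} k n} (h : SES N₁ N₂ N₃)
    (h₁ : Resolvable (fun j => A (j + 1)) N₁) (h₂ : Resolvable A N₂) : Resolvable A N₃ := by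
  obtain ⟨K, ⟨ι, b, hb, hs⟩, hK⟩ := h₂.exists_step
  obtain ⟨E, hE, hE'⟩ := hs.comp h
  exact of_step ⟨ι, b, hb, hE⟩ (hK.ext hE' h₁)

end Resolvable

/-- The zero module. -/
noncomputable def GrMod.zero : GrMod.{u, v} k n where
  carrier := PUnit
  proj _ := 0
  proj_proj _ _ := rfl
  proj_proj_ne _ _ _ _ := rfl
  exists_sum _ := ⟨∅, rfl⟩
  proj_smul _ _ _ _ _ := rfl

instance : Subsingleton (GrMod.zero : GrMod.{u, v} k n) := inferInstanceAs (Subsingleton PUnit)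

theorem ses_of_bijective {N N' : GrMod.{u, v} k n} {f : N →ₗ[CoxRing k n] N'} (hf : IsGr _ _ f)
    (h : Function.Bijective f) : SES N N' GrMod.zero :=
  ⟨f, 0, hf, fun _ _ => (map_zero _).symm, h.1,
    fun x => ⟨fun _ => h.2 x, fun _ => rfl⟩, fun _ => ⟨0, Subsingleton.elim _ _⟩⟩

theorem ses_of_bijective_symm {N N' : GrMod.{u, v} k n} {f : N →ₗ[CoxRing k n] N'}
    (hf : IsGr _ _ f) (h : Function.Bijective f) : SES N' N GrMod.zero := by
  obtain ⟨q, hq, hqq⟩ := exists_lift_of_injective hf h.1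
    (g := LinearMap.id) (fun _ _ => rfl) fun x => h.2 x
  refine ses_of_bijective hq ⟨fun x y hxy => ?_, fun y => ⟨f y, h.1 (hqq _)⟩⟩
  have := hqq x
  rw [hxy, hqq] at this
  exact this.symm

theorem Resolvable.of_ses_subsingleton {A : ℕ → Set (Fin r → ℤ)} {N N' Z : GrMod.{u, v} k n}
    [Subsingleton Z] (h : SES N N' Z) (hN : Resolvable A N) : Resolvable A N' :=
  hN.ext h (of_subsingleton Z)

theorem ses_zero_left (N : GrMod.{u, v} k n) : SES GrMod.zero N N :=
  ⟨0, LinearMap.id, fun _ _ => (map_zero _).symm, fun _ _ => rfl,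
    fun _ _ _ => Subsingleton.elim _ _,
    fun x => ⟨fun hx => ⟨0, Eq.symm hx⟩, by rintro ⟨y, rfl⟩; rfl⟩, fun x => ⟨x, rfl⟩⟩

/-- The middle term of a short exact sequence can be replaced along a degree preserving
bijection. -/
theorem SES.congr_middle {N₁ N₂ N₃ X : GrMod.{u, v} k n} (h : SES N₁ N₂ N₃)
    {f : X →ₗ[CoxRing k n] N₂} (hf : IsGr _ _ f) (hb : Function.Bijective f) : SES N₁ X N₃ := by
  obtain ⟨i, p, hi, hp, inj, ex, surj⟩ := h
  obtain ⟨j, hj, hfj⟩ := exists_lift_of_injective hf hb.1 hi fun x => hb.2 (i x)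
  refine ⟨j, p ∘ₗ f, hj, hp.comp hf, fun x y hxy => inj ?_, fun x => ⟨fun hx => ?_, ?_⟩,
    surj.comp hb.2⟩
  · rw [← hfj, hxy, hfj]
  · obtain ⟨y, hy⟩ := (ex _).1 hx
    exact ⟨y, hb.1 ((hfj y).trans hy)⟩
  · rintro ⟨y, rfl⟩
    rw [LinearMap.comp_apply, hfj]
    exact (ex _).2 ⟨y, rfl⟩

/-! ### Truncation and its exactness -/

/-- The truncation of a graded module as a submodule. -/
noncomputable def GrMod.truncSubmodule (N : GrMod.{u, v} k n) (c : Fin r → ℤ) :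
    Submodule (CoxRing k n) N where
  carrier := {m | ∀ e, ¬ c ≤ e → N.proj e m = 0}
  add_mem' ha hb e he := by rw [map_add, ha e he, hb e he, add_zero]
  zero_mem' _ _ := map_zero _
  smul_mem' s m hm e he := by
    induction s using MvPolynomial.induction_on' with
    | monomial p t =>
      have h1 : MvPolynomial.monomial p t ∈ coxGrading k n (Finsupp.weight (varDegree n) p) :=
        MvPolynomial.isWeightedHomogeneous_monomial _ _ _ rfl
      have h2 := N.proj_smul _ (e - Finsupp.weight (varDegree n) p) _ h1 m
      rw [add_sub_cancel] at h2
      rw [h2, hm, smul_zero]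
      exact fun h => he (h.trans (sub_le_self _ (weight_varDegree_nonneg n p)))
    | add p q hp hq => rw [add_smul, map_add, hp, hq, add_zero]

theorem GrMod.proj_mem_truncSubmodule (N : GrMod.{u, v} k n) (c e : Fin r → ℤ) (m : N)
    (hm : m ∈ N.truncSubmodule c) : N.proj e m ∈ N.truncSubmodule c := fun e' he' => by
  by_cases h : e' = e
  · rw [h, N.proj_proj, ← h, hm e' he']
  · exact N.proj_proj_ne _ _ _ h

/-- The truncation of a graded module. -/
noncomputable def GrMod.trunc (N : GrMod.{u, v} k n) (c : Fin r → ℤ) : GrMod.{u, v} k n :=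
  N.sub (N.truncSubmodule c) (N.proj_mem_truncSubmodule c)

/-- The inclusion of the truncation. -/
noncomputable def GrMod.truncIncl (N : GrMod.{u, v} k n) (c : Fin r → ℤ) :
    N.trunc c →ₗ[CoxRing k n] N := N.incl _ _

theorem GrMod.isGr_truncIncl (N : GrMod.{u, v} k n) (c : Fin r → ℤ) :
    IsGr _ _ (N.truncIncl c) := N.isGr_incl _ _

theorem GrMod.truncIncl_injective (N : GrMod.{u, v} k n) (c : Fin r → ℤ) :
    Function.Injective (N.truncIncl c) := N.incl_injective _ _

theorem GrMod.exists_truncIncl_iff {N : GrMod.{u, v} k n} {c : Fin r → ℤ} {m : N} :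
    (∃ x, N.truncIncl c x = m) ↔ ∀ e, ¬ c ≤ e → N.proj e m = 0 :=
  ⟨by rintro ⟨x, rfl⟩; exact x.2, fun h => ⟨⟨m, h⟩, rfl⟩⟩

theorem IsGr.exists_trunc {N N' : GrMod.{u, v} k n} {f : N →ₗ[CoxRing k n] N'} (hf : IsGr _ _ f)
    (c : Fin r → ℤ) : ∃ f' : N.trunc c →ₗ[CoxRing k n] N'.trunc c, IsGr _ _ f' ∧
      ∀ x, N'.truncIncl c (f' x) = f (N.truncIncl c x) :=
  exists_lift_of_injective (N'.isGr_truncIncl c) (N'.truncIncl_injective c)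
    (hf.comp (N.isGr_truncIncl c)) fun x => GrMod.exists_truncIncl_iff.2 fun e he => by
      rw [LinearMap.comp_apply, ← hf, GrMod.exists_truncIncl_iff.1 ⟨x, rfl⟩ e he, map_zero]

theorem SES.trunc {N₁ N₂ N₃ : GrMod.{u, v} k n} (h : SES N₁ N₂ N₃) (c : Fin r → ℤ) :
    SES (N₁.trunc c) (N₂.trunc c) (N₃.trunc c) := by
  classical
  obtain ⟨f, g, hf, hg, inj, ex, surj⟩ := h
  obtain ⟨f', hf', hff⟩ := hf.exists_trunc c
  obtain ⟨g', hg', hgg⟩ := hg.exists_trunc c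
  refine ⟨f', g', hf', hg', fun x y hxy => ?_, fun x => ⟨fun hx => ?_, ?_⟩, fun y => ?_⟩
  · apply N₁.truncIncl_injective c
    apply inj
    rw [← hff, hxy, hff]
  · obtain ⟨y, hy⟩ := (ex (N₂.truncIncl c x)).1 (by rw [← hgg, hx, map_zero])
    obtain ⟨z, rfl⟩ := (GrMod.exists_truncIncl_iff (c := c) (m := y)).2 fun e he => by
      apply inj
      rw [hf, hy, map_zero]
      exact GrMod.exists_truncIncl_iff.1 ⟨x, rfl⟩ e he
    exact ⟨z, N₂.truncIncl_injective c (by rw [hff, hy])⟩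
  · rintro ⟨y, rfl⟩
    apply N₃.truncIncl_injective c
    rw [hgg, hff, map_zero]
    exact (ex _).2 ⟨_, rfl⟩
  · obtain ⟨x, hx⟩ := surj (N₃.truncIncl c y)
    obtain ⟨s, hs, hsum⟩ := N₂.exists_sum_superset x
    -- Of a preimage of `y` only the components in degrees ≥ c are kept; the discarded ones map to
    -- components of `y` that vanish.
    obtain ⟨z, hz⟩ := (GrMod.exists_truncIncl_iff (c := c)
      (m := ∑ e ∈ s with c ≤ e, N₂.proj e x)).2 fun e he => by
        rw [map_sum]
        refine Finset.sum_eq_zero fun e' he' => N₂.proj_proj_ne _ _ _ ?_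
        rintro rfl
        exact he (Finset.mem_filter.1 he').2
    refine ⟨z, N₃.truncIncl_injective c ?_⟩
    rw [hgg, hz, ← hx]
    conv_rhs => rw [← hsum]
    rw [map_sum, map_sum]
    refine Finset.sum_subset (Finset.filter_subset _ _) fun e he he' => ?_
    rw [hg, hx]
    refine GrMod.exists_truncIncl_iff.1 ⟨y, rfl⟩ e fun hc => he' ?_
    exact Finset.mem_filter.2 ⟨he, hc⟩

instance (N : GrMod.{u, v} k n) [Subsingleton N] (c : Fin r → ℤ) : Subsingleton (N.trunc c) :=
  (N.truncIncl_injective c).subsingleton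

/-! ### Direct sums, for free modules of arbitrary rank -/

/-- The direct sum of graded modules. -/
noncomputable def GrMod.directSum {α : Type (max u v)} (N : α → GrMod.{u, v} k n) :
    GrMod.{u, v} k n where
  carrier := Π₀ a, N a
  proj e := DFinsupp.mapRange.addMonoidHom fun a => (N a).proj e
  proj_proj e m := DFinsupp.ext fun a => (N a).proj_proj e (m a)
  proj_proj_ne e e' m h := DFinsupp.ext fun a => (N a).proj_proj_ne e e' (m a) h
  exists_sum m := by
    classical
    choose s hs hsum using fun a => (N a).exists_sum_superset (m a)
    refine ⟨m.support.biUnion s, DFinsupp.ext fun a => ?_⟩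
    rw [DFinsupp.finsetSum_apply]
    change ∑ e ∈ _, (N a).proj e (m a) = _
    by_cases ha : a ∈ m.support
    · conv_rhs => rw [← hsum a]
      exact (Finset.sum_subset (Finset.subset_biUnion_of_mem s ha) fun e _ he => hs a e he).symm
    · rw [DFinsupp.notMem_support_iff.1 ha]
      exact Finset.sum_eq_zero fun e _ => map_zero _
  proj_smul a e s hs m := DFinsupp.ext fun i => (N i).proj_smul a e s hs (DFinsupp.toFun (β := fun a => N a) m i)

/-- The direct sum of linear maps. -/
noncomputable def directSumMap {α : Type (max u v)} {N N' : α → GrMod.{u, v} k n}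
    (f : ∀ a, N a →ₗ[CoxRing k n] N' a) :
    GrMod.directSum N →ₗ[CoxRing k n] GrMod.directSum N' :=
  DFinsupp.mapRange.linearMap f

theorem isGr_directSumMap {α : Type (max u v)} {N N' : α → GrMod.{u, v} k n}
    {f : ∀ a, N a →ₗ[CoxRing k n] N' a} (hf : ∀ a, IsGr _ _ (f a)) :
    IsGr _ _ (directSumMap f) := fun e m => DFinsupp.ext fun a =>
  hf a e (DFinsupp.toFun (β := fun a => N a) m a)

theorem directSumMap_injective {α : Type (max u v)} {N N' : α → GrMod.{u, v} k n}
    {f : ∀ a, N a →ₗ[CoxRing k n] N' a} (hf : ∀ a, Function.Injective (f a)) :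
    Function.Injective (directSumMap f) := fun _ _ hxy => DFinsupp.ext fun a =>
  hf a (congrArg (fun z : Π₀ a, N' a => z a) hxy)

theorem exists_directSumMap_eq {α : Type (max u v)} {N N' : α → GrMod.{u, v} k n}
    {f : ∀ a, N a →ₗ[CoxRing k n] N' a} (y : Π₀ a, N' a) (h : ∀ a, ∃ x, f a x = y a) :
    ∃ x, directSumMap f x = y := by
  classical
  choose g hg using h
  refine ⟨(DFinsupp.mk y.support fun a => g a : Π₀ a, N a), DFinsupp.ext fun a => ?_⟩
  change f a ((DFinsupp.mk y.support fun a => g a : Π₀ a, N a) a) = y a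
  rw [DFinsupp.mk_apply]
  split_ifs with ha
  · exact hg a
  · rw [map_zero, DFinsupp.notMem_support_iff.1 ha]

theorem SES.directSum {α : Type (max u v)} {N₁ N₂ N₃ : α → GrMod.{u, v} k n}
    (h : ∀ a, SES (N₁ a) (N₂ a) (N₃ a)) :
    SES (GrMod.directSum N₁) (GrMod.directSum N₂) (GrMod.directSum N₃) := by
  choose f g hf hg inj ex surj using h
  refine ⟨directSumMap f, directSumMap g, isGr_directSumMap hf, isGr_directSumMap hg,
    directSumMap_injective inj, fun y => ⟨fun hy => ?_, ?_⟩, fun y => ?_⟩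
  · exact exists_directSumMap_eq y fun a =>
      (ex a _).1 (congrArg (fun z : Π₀ a, N₃ a => z a) hy)
  · rintro ⟨x, rfl⟩
    exact DFinsupp.ext fun a => (ex a _).2 ⟨_, rfl⟩
  · exact exists_directSumMap_eq y fun a => surj a _

theorem ses_directSum_trunc {α : Type (max u v)} (N : α → GrMod.{u, v} k n) (c : Fin r → ℤ) :
    SES (GrMod.directSum fun a => (N a).trunc c) ((GrMod.directSum N).trunc c) GrMod.zero := by
  have h1 : IsGr _ _ (directSumMap fun a => (N a).truncIncl c) :=
    isGr_directSumMap fun a => (N a).isGr_truncIncl c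
  obtain ⟨f, hf, hff⟩ := exists_lift_of_injective ((GrMod.directSum N).isGr_truncIncl c)
    ((GrMod.directSum N).truncIncl_injective c) h1 fun x =>
      GrMod.exists_truncIncl_iff.2 fun e he => DFinsupp.ext fun a =>
        GrMod.exists_truncIncl_iff.1 ⟨DFinsupp.toFun (β := fun a => (N a).trunc c) x a, rfl⟩ e he
  refine ses_of_bijective hf ⟨fun x y hxy => ?_, fun y => ?_⟩
  · refine directSumMap_injective (fun a => (N a).truncIncl_injective c) ?_
    rw [← hff, hxy, hff]
  · obtain ⟨x, hx⟩ := exists_directSumMap_eq (f := fun a => (N a).truncIncl c)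
      ((GrMod.directSum N).truncIncl c y) fun a => GrMod.exists_truncIncl_iff.2 fun e he =>
        congrArg (fun z : Π₀ a, N a => z a) (GrMod.exists_truncIncl_iff.1 ⟨y, rfl⟩ e he)
    exact ⟨x, (GrMod.directSum N).truncIncl_injective c ((hff x).trans hx)⟩

theorem exists_free_sigma {α : Type (max u v)} {ι : α → Type (max u v)}
    (b : ∀ a, ι a → Fin r → ℤ) :
    ∃ f : free.{u, v} (k := k) (n := n) (fun x : Σ a, ι a => b x.1 x.2) →ₗ[CoxRing k n]
        GrMod.directSum fun a => free.{u, v} (k := k) (n := n) (b a),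
      IsGr _ _ f ∧ Function.Bijective f := by
  classical
  let e := sigmaFinsuppLequivDFinsupp (CoxRing k n) (ι := α) (η := ι) (N := CoxRing k n)
  refine ⟨e.toLinearMap ∘ₗ (toFree _).symm.toLinearMap, fun d m => ?_,
    e.bijective.comp (toFree _).symm.bijective⟩
  exact DFinsupp.ext fun a => Finsupp.ext fun i => rfl

theorem exists_free_reindex {α β : Type (max u v)} (b : β → Fin r → ℤ) (σ : α ≃ β) :
    ∃ f : free.{u, v} (k := k) (n := n) (fun a => b (σ a)) →ₗ[CoxRing k n]
        free.{u, v} (k := k) (n := n) b,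
      IsGr _ _ f ∧ Function.Bijective f := by
  refine ⟨(toFree _).toLinearMap ∘ₗ
    (Finsupp.domLCongr (M := CoxRing k n) (R := CoxRing k n) σ).toLinearMap ∘ₗ
    (toFree _).symm.toLinearMap, IsGr.of_mem_piece fun e m hm => ?_,
    (toFree _).bijective.comp ((Finsupp.domLCongr (M := CoxRing k n) (R := CoxRing k n)
      σ).bijective.comp (toFree _).symm.bijective)⟩
  rw [mem_free_piece] at hm ⊢
  intro a
  have := hm (σ.symm a)
  simpa [Finsupp.domLCongr_apply, Finsupp.domCongr_apply] using this

theorem Resolvable.directSum {A : ℕ → Set (Fin r → ℤ)} {α : Type (max u v)}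
    {N : α → GrMod.{u, v} k n} (h : ∀ a, Resolvable A (N a)) :
    Resolvable A (GrMod.directSum N) := by
  -- The summands are resolved simultaneously: a direct sum of `j`-th syzygies again has a direct
  -- sum of syzygies as its kernel.
  refine ⟨fun j X => ∃ N' : α → GrMod.{u, v} k n,
    X = GrMod.directSum N' ∧ ∀ a, Resolvable (fun i => A (j + i)) (N' a),
    ⟨N, rfl, fun a => by simpa only [zero_add] using h a⟩, ?_⟩
  rintro j X ⟨N', rfl, hN'⟩
  choose K hK hres using fun a => (hN' a).exists_step
  choose ι b hb hses using hK
  obtain ⟨f, hf, hbij⟩ := exists_free_sigma.{u, v} (k := k) (n := n) b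
  have h1 := (SES.directSum hses).congr_middle hf hbij
  have h2 : Step (A j) (GrMod.directSum N') (GrMod.directSum K) :=
    ⟨Σ a, ι a, fun x => b x.1 x.2, fun x => hb x.1 x.2, h1⟩
  refine ⟨GrMod.directSum K, h2, K, rfl, fun a => ?_⟩
  have h3 := hres a
  simp only [add_assoc, add_comm 1] at h3 ⊢
  exact h3

/-- Truncation commutes with direct sums, which reduces any rank to rank one. -/
theorem Resolvable.trunc_free {A : ℕ → Set (Fin r → ℤ)} {ι : Type (max u v)} (b : ι → Fin r → ℤ)
    (c : Fin r → ℤ)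
    (h : ∀ a, Resolvable A
      ((free.{u, v} (k := k) (n := n) fun _ : PUnit.{max u v + 1} => b a).trunc c)) :
    Resolvable A ((free.{u, v} (k := k) (n := n) b).trunc c) := by
  obtain ⟨f, hf, hbij⟩ := exists_free_sigma.{u, v} (k := k) (n := n)
    fun (a : ι) (_ : PUnit.{max u v + 1}) => b a
  obtain ⟨g, hg, hgbij⟩ := exists_free_reindex.{u, v} (k := k) (n := n)
    (fun x : Σ _ : ι, PUnit.{max u v + 1} => b x.1) (Equiv.sigmaPUnit ι).symm
  have h1 := (Resolvable.directSum h).of_ses_subsingleton (ses_directSum_trunc _ c)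
  exact h1.of_ses_subsingleton
    ((ses_of_bijective_symm (hf.comp hg) (hbij.comp hgbij)).trunc c)

/-! ### Assembling a resolution of the truncation -/

/-- A resolution of `K` yields one of a truncation of `K`, provided that the truncations of the
free modules occurring in it have resolutions with suitably bounded degrees. -/
theorem Resolvable.trunc {A B : ℕ → Set (Fin r → ℤ)} {c : Fin r → ℤ} {K : GrMod.{u, v} k n}
    (hK : Resolvable A K)
    (h : ∀ j, ∀ b ∈ A j, Resolvable (fun i => B (j + i))
      ((free.{u, v} (k := k) (n := n) fun _ : PUnit.{max u v + 1} => b).trunc c)) :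
    Resolvable B (K.trunc c) := by
  obtain ⟨P, hP, hP'⟩ := hK
  -- The `j`-th syzygy under construction is an extension of the truncated `j`-th syzygy `X` of `K`
  -- by a module `L`, which gathers what remains to be resolved of the truncated earlier terms.
  refine ⟨fun j E => ∃ L X, SES L E (GrMod.trunc X c) ∧ Resolvable (fun i => B (j + i)) L ∧ P j X,
    ⟨GrMod.zero, K, ses_zero_left _, of_subsingleton _, hP⟩, ?_⟩
  rintro j E ⟨L, X, hE, hL, hX⟩
  obtain ⟨Y, ⟨ι, b, hb, hses⟩, hY⟩ := hP' j X hX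
  have hF := Resolvable.trunc_free (A := fun i => B (j + i)) b c fun a => h j _ (hb a)
  obtain ⟨L₁, ⟨ι₁, b₁, hb₁, hses₁⟩, hL₁⟩ := hF.exists_step
  obtain ⟨L₂, hstep₂, hL₂⟩ := hL.exists_step
  -- The cover of the truncated free module also covers the truncation of `X`, with kernel `E₁` an
  -- extension of `Y.trunc c` by `L₁`. The horseshoe with `L` then gives a kernel `E'`, an extension
  -- of `E₁` by `L₂`. Regrouping, `E'` maps onto `Y.trunc c` with kernel `L'`, an extension of `L₁`
  -- by `L₂`, so the invariant persists.
  obtain ⟨E₁, hE₁, hE₁'⟩ := hses₁.comp (hses.trunc c)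
  obtain ⟨E', hE', hE'ses⟩ := hstep₂.horseshoe hE ⟨ι₁, b₁, hb₁, hE₁⟩
  obtain ⟨L', hL', hL''⟩ := hE'ses.comp hE₁'
  exact ⟨E', hE', L', Y, hL', by simpa only [add_assoc, add_comm 1] using hL₂.ext hL'' hL₁, hY⟩

/-! ### Quotients of the Cox ring by sets of variables -/

/-- The quotient map. -/
noncomputable def GrMod.quotMk (N : GrMod.{u, v} k n) (U : Submodule (CoxRing k n) N)
    (hU : ∀ e, ∀ m ∈ U, N.proj e m ∈ U) : N →ₗ[CoxRing k n] N.quot U hU := U.mkQ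

theorem GrMod.isGr_quotMk (N : GrMod.{u, v} k n) (U : Submodule (CoxRing k n) N)
    (hU : ∀ e, ∀ m ∈ U, N.proj e m ∈ U) : IsGr _ _ (N.quotMk U hU) := fun _ _ => rfl

theorem GrMod.quotMk_surjective (N : GrMod.{u, v} k n) (U : Submodule (CoxRing k n) N)
    (hU : ∀ e, ∀ m ∈ U, N.proj e m ∈ U) : Function.Surjective (N.quotMk U hU) := U.mkQ_surjective

theorem GrMod.quotMk_eq_zero {N : GrMod.{u, v} k n} {U : Submodule (CoxRing k n) N}
    {hU : ∀ e, ∀ m ∈ U, N.proj e m ∈ U} {x : N} : N.quotMk U hU x = 0 ↔ x ∈ U :=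
  Submodule.Quotient.mk_eq_zero U

theorem GrMod.exists_quot_lift {N N' : GrMod.{u, v} k n} {U : Submodule (CoxRing k n) N}
    {hU : ∀ e, ∀ m ∈ U, N.proj e m ∈ U} {f : N →ₗ[CoxRing k n] N'} (hf : IsGr _ _ f)
    (h : ∀ x ∈ U, f x = 0) :
    ∃ f' : N.quot U hU →ₗ[CoxRing k n] N', IsGr _ _ f' ∧ ∀ x, f' (N.quotMk U hU x) = f x := by
  refine ⟨U.liftQ f fun x hx => h x hx, fun e m => ?_, fun x => rfl⟩
  obtain ⟨m, rfl⟩ := N.quotMk_surjective U hU m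
  exact hf e m

/-- The ideal generated by the variables in `V`. -/
noncomputable def varIdeal (k : Type u) [Field k] {r : ℕ} (n : Fin r → ℕ)
    (V : Finset (Σ i : Fin r, Fin (n i + 1))) : Ideal (CoxRing k n) :=
  Ideal.span (MvPolynomial.X '' (V : Set (Σ i : Fin r, Fin (n i + 1))))

theorem mem_varIdeal {V : Finset (Σ i : Fin r, Fin (n i + 1))} {p : CoxRing k n} :
    p ∈ varIdeal k n V ↔ ∀ m, MvPolynomial.coeff m p ≠ 0 → ∃ i ∈ V, m i ≠ 0 := by
  rw [varIdeal, MvPolynomial.mem_ideal_span_X_image]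
  simp only [MvPolynomial.mem_support_iff, Finset.mem_coe]

theorem component_mem_varIdeal {V : Finset (Σ i : Fin r, Fin (n i + 1))} {p : CoxRing k n}
    (hp : p ∈ varIdeal k n V) (e : Fin r → ℤ) :
    MvPolynomial.weightedHomogeneousComponent (varDegree n) e p ∈ varIdeal k n V := by
  classical
  rw [mem_varIdeal] at *
  intro m hm
  rw [MvPolynomial.coeff_weightedHomogeneousComponent] at hm
  exact hp m fun h => hm (by rw [h, ite_self])

/-- A variable outside `V` is a nonzerodivisor modulo `V`: this is the injectivity needed in
`ses_varQuot`. -/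
theorem mem_varIdeal_of_X_mul_mem {V : Finset (Σ i : Fin r, Fin (n i + 1))}
    {x : Σ i : Fin r, Fin (n i + 1)} (hx : x ∉ V) {p : CoxRing k n}
    (hp : MvPolynomial.X x * p ∈ varIdeal k n V) : p ∈ varIdeal k n V := by
  classical
  rw [mem_varIdeal] at *
  intro m hm
  obtain ⟨i, hi, h⟩ := hp (Finsupp.single x 1 + m) (by rwa [MvPolynomial.coeff_X_mul])
  refine ⟨i, hi, ?_⟩
  have hix : i ≠ x := fun hix => hx (hix ▸ hi)
  rwa [Finsupp.add_apply, Finsupp.single_eq_of_ne hix, zero_add] at h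

theorem mem_varIdeal_insert {V : Finset (Σ i : Fin r, Fin (n i + 1))}
    {x : Σ i : Fin r, Fin (n i + 1)} {p : CoxRing k n} :
    p ∈ varIdeal k n (insert x V) ↔ ∃ s, ∃ q ∈ varIdeal k n V, p = s * MvPolynomial.X x + q := by
  rw [varIdeal, Finset.coe_insert, Set.image_insert_eq, Ideal.mem_span_insert]
  rfl

/-- Only variables of block `i` contribute to the `i`-th coordinate of a weight, so a monomial of
positive `i`-th degree involves one of them. -/
theorem mem_varIdeal_of_weight_pos {V : Finset (Σ i : Fin r, Fin (n i + 1))} {i : Fin r}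
    (hV : ∀ j, (⟨i, j⟩ : Σ i : Fin r, Fin (n i + 1)) ∈ V) {e : Fin r → ℤ} (he : 0 < e i)
    {p : CoxRing k n} (hp : p ∈ coxGrading k n e) : p ∈ varIdeal k n V := by
  rw [mem_varIdeal]
  intro m hm
  by_contra! hne
  have h1 : Finsupp.weight (varDegree n) m = e := hp hm
  rw [← h1, Finsupp.weight_apply, Finsupp.sum, Finset.sum_apply] at he
  refine he.ne' (Finset.sum_eq_zero fun x _ => ?_)
  obtain ⟨i', j⟩ := x
  rw [Pi.smul_apply, varDegree]
  by_cases h : i = i'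
  · subst h
    rw [hne _ (hV j), zero_smul]
  · rw [Pi.single_eq_of_ne h, smul_zero]

/-- The free module on one generator of degree `b`. -/
noncomputable abbrev freeOne (k : Type u) [Field k] {r : ℕ} (n : Fin r → ℕ) (b : Fin r → ℤ) :
    GrMod.{u, v} k n :=
  free.{u, v} (k := k) (n := n) fun _ : PUnit.{max u v + 1} => b

/-- The identification of the Cox ring with `freeOne`. -/
noncomputable def toFreeOne (b : Fin r → ℤ) : CoxRing k n ≃ₗ[CoxRing k n] freeOne.{u, v} k n b :=
  (Finsupp.uniqueLinearEquiv (CoxRing k n) (CoxRing k n) PUnit.unit).symm ≪≫ₗ toFree _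

theorem freeOne_proj (b e : Fin r → ℤ) (p : CoxRing k n) :
    (freeOne.{u, v} k n b).proj e (toFreeOne b p) =
      toFreeOne b (MvPolynomial.weightedHomogeneousComponent (varDegree n) (e - b) p) := by
  apply (toFree _).symm.injective
  refine Finsupp.ext fun a => ?_
  rw [free_proj_apply]
  simp [toFreeOne, Finsupp.uniqueLinearEquiv]

/-- The multiples of the generator of `freeOne` by elements of `varIdeal`. -/
noncomputable def varSubmodule (V : Finset (Σ i : Fin r, Fin (n i + 1))) (b : Fin r → ℤ) :
    Submodule (CoxRing k n) (freeOne.{u, v} k n b) :=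
  Submodule.map (toFreeOne b).toLinearMap (varIdeal k n V)

theorem toFreeOne_mem_varSubmodule {V : Finset (Σ i : Fin r, Fin (n i + 1))} {b : Fin r → ℤ}
    {p : CoxRing k n} :
    toFreeOne b p ∈ varSubmodule.{u, v} V b ↔ p ∈ varIdeal k n V :=
  Function.Injective.mem_set_image (toFreeOne b).injective

theorem proj_mem_varSubmodule (V : Finset (Σ i : Fin r, Fin (n i + 1))) (b e : Fin r → ℤ)
    (m : freeOne.{u, v} k n b) (hm : m ∈ varSubmodule V b) :
    (freeOne.{u, v} k n b).proj e m ∈ varSubmodule V b := by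
  obtain ⟨p, rfl⟩ := (toFreeOne b).surjective m
  rw [toFreeOne_mem_varSubmodule] at hm
  rw [freeOne_proj, toFreeOne_mem_varSubmodule]
  exact component_mem_varIdeal hm _

/-- The quotient of the Cox ring by the variables in `V`, generated in degree `b`. -/
noncomputable def varQuot (k : Type u) [Field k] {r : ℕ} (n : Fin r → ℕ)
    (V : Finset (Σ i : Fin r, Fin (n i + 1))) (b : Fin r → ℤ) :
    GrMod.{u, v} k n :=
  (freeOne.{u, v} k n b).quot (varSubmodule V b) (proj_mem_varSubmodule V b)

/-- The quotient map onto `varQuot`. -/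
noncomputable def toVarQuot (V : Finset (Σ i : Fin r, Fin (n i + 1))) (b : Fin r → ℤ) :
    freeOne.{u, v} k n b →ₗ[CoxRing k n] varQuot.{u, v} k n V b :=
  GrMod.quotMk _ _ _

theorem isGr_toVarQuot (V : Finset (Σ i : Fin r, Fin (n i + 1))) (b : Fin r → ℤ) :
    IsGr _ _ (toVarQuot.{u, v} (k := k) (n := n) V b) := GrMod.isGr_quotMk _ _ _

theorem exists_toVarQuot_eq {V : Finset (Σ i : Fin r, Fin (n i + 1))} {b : Fin r → ℤ}
    (m : varQuot.{u, v} k n V b) : ∃ p, toVarQuot V b (toFreeOne b p) = m := by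
  obtain ⟨f, hf⟩ := GrMod.quotMk_surjective _ _ (proj_mem_varSubmodule V b) m
  obtain ⟨p, rfl⟩ := (toFreeOne b).surjective f
  exact ⟨p, hf⟩

theorem toVarQuot_eq_zero {V : Finset (Σ i : Fin r, Fin (n i + 1))} {b : Fin r → ℤ}
    {p : CoxRing k n} :
    toVarQuot.{u, v} V b (toFreeOne b p) = 0 ↔ p ∈ varIdeal k n V :=
  GrMod.quotMk_eq_zero.trans toFreeOne_mem_varSubmodule

theorem exists_varQuot_lift {V : Finset (Σ i : Fin r, Fin (n i + 1))} {b : Fin r → ℤ}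
    {N' : GrMod.{u, v} k n} {f : freeOne.{u, v} k n b →ₗ[CoxRing k n] N'} (hf : IsGr _ _ f)
    (h : ∀ p ∈ varIdeal k n V, f (toFreeOne b p) = 0) :
    ∃ f' : varQuot.{u, v} k n V b →ₗ[CoxRing k n] N', IsGr _ _ f' ∧
      ∀ x, f' (toVarQuot V b x) = f x :=
  GrMod.exists_quot_lift hf (by
    rintro _ ⟨p, hp, rfl⟩
    exact h p hp)

/-- The left map is multiplication by the variable `x`, whose degree accounts for the shift of `b`.
-/
theorem ses_varQuot {V : Finset (Σ i : Fin r, Fin (n i + 1))} {x : Σ i : Fin r, Fin (n i + 1)}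
    (hx : x ∉ V) (b : Fin r → ℤ) :
    SES (varQuot.{u, v} k n V (b + Pi.single x.1 1)) (varQuot k n V b)
      (varQuot k n (insert x V) b) := by
  have hX : (MvPolynomial.X x : CoxRing k n) ∈ coxGrading k n (Pi.single x.1 1) :=
    MvPolynomial.isWeightedHomogeneous_X _ _ _
  let F : freeOne.{u, v} k n (b + Pi.single x.1 1) →ₗ[CoxRing k n] freeOne.{u, v} k n b :=
    (toFreeOne b).toLinearMap ∘ₗ LinearMap.mulLeft _ (MvPolynomial.X x) ∘ₗ
      (toFreeOne (b + Pi.single x.1 1)).symm.toLinearMap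
  have hFp : ∀ p, F (toFreeOne _ p) = toFreeOne b (MvPolynomial.X x * p) := fun p => by simp [F]
  have hF : IsGr _ _ F := fun e m => by
    obtain ⟨p, rfl⟩ := (toFreeOne _).surjective m
    rw [freeOne_proj, hFp, hFp, freeOne_proj, ← weightedHomogeneousComponent_mul hX]
    congr 3
    abel
  obtain ⟨f, hf, hfF⟩ := exists_varQuot_lift (V := V) ((isGr_toVarQuot V b).comp hF) fun p hp => by
    rw [LinearMap.comp_apply, hFp, toVarQuot_eq_zero]
    exact Ideal.mul_mem_left _ _ hp
  obtain ⟨g, hg, hgG⟩ := exists_varQuot_lift (V := V)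
    (isGr_toVarQuot.{u, v} (k := k) (insert x V) b) fun p hp => by
      rw [toVarQuot_eq_zero, mem_varIdeal_insert]
      exact ⟨0, p, hp, by rw [zero_mul, zero_add]⟩
  refine ⟨f, g, hf, hg, ?_, fun m => ?_, fun m => ?_⟩
  · rw [← LinearMap.ker_eq_bot, LinearMap.ker_eq_bot']
    intro m hm
    obtain ⟨p, rfl⟩ := exists_toVarQuot_eq m
    rw [hfF, LinearMap.comp_apply, hFp, toVarQuot_eq_zero] at hm
    exact toVarQuot_eq_zero.2 (mem_varIdeal_of_X_mul_mem hx hm)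
  · obtain ⟨p, rfl⟩ := exists_toVarQuot_eq m
    rw [hgG, toVarQuot_eq_zero, mem_varIdeal_insert]
    constructor
    · rintro ⟨s, q, hq, rfl⟩
      refine ⟨toVarQuot _ _ (toFreeOne _ s), ?_⟩
      rw [hfF, LinearMap.comp_apply, hFp, map_add, map_add, toVarQuot_eq_zero.2 hq, add_zero,
        mul_comm]
    · rintro ⟨m', hm'⟩
      obtain ⟨s, rfl⟩ := exists_toVarQuot_eq m'
      rw [hfF, LinearMap.comp_apply, hFp, eq_comm, ← sub_eq_zero, ← map_sub, ← map_sub,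
        toVarQuot_eq_zero] at hm'
      exact ⟨s, _, hm', by ring⟩
  · obtain ⟨p, rfl⟩ := exists_toVarQuot_eq m
    exact ⟨_, hgG _⟩

/-! ### Linear resolutions of truncated quotients -/

/-- The degrees allowed in the `j`-th term of a linear resolution generated in degree `e`. -/
def linDegrees {r : ℕ} (e : Fin r → ℤ) (j : ℕ) : Set (Fin r → ℤ) :=
  {b | ∃ l : Fin r → ℕ, ∑ t, l t = j ∧ b = e + fun t => (l t : ℤ)}

theorem linDegrees_add_single_subset (e : Fin r → ℤ) (i : Fin r) (j : ℕ) :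
    linDegrees (e + Pi.single i 1) j ⊆ linDegrees e (j + 1) := by
  rintro _ ⟨l, hl, rfl⟩
  refine ⟨l + Pi.single i 1, ?_, ?_⟩
  · simp [Finset.sum_add_distrib, hl]
  · funext t
    by_cases h : t = i
    · subst h
      simp
      ring
    · simp [h]

theorem bijective_toVarQuot_empty (b : Fin r → ℤ) :
    Function.Bijective (toVarQuot.{u, v} (k := k) (n := n) ∅ b) := by
  refine ⟨?_, fun m => ?_⟩
  · rw [← LinearMap.ker_eq_bot, LinearMap.ker_eq_bot']
    intro m hm
    obtain ⟨p, rfl⟩ := (toFreeOne b).surjective m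
    rw [toVarQuot_eq_zero, varIdeal, Finset.coe_empty, Set.image_empty, Ideal.span_empty,
      Ideal.mem_bot] at hm
    rw [hm, map_zero]
  · obtain ⟨p, hp⟩ := exists_toVarQuot_eq m
    exact ⟨_, hp⟩

theorem bijective_truncIncl_free {ι : Type (max u v)} {b : ι → Fin r → ℤ} {c : Fin r → ℤ}
    (h : ∀ a, c ≤ b a) :
    Function.Bijective ((free.{u, v} (k := k) (n := n) b).truncIncl c) := by
  refine ⟨GrMod.truncIncl_injective _ c, fun m => GrMod.exists_truncIncl_iff.2 fun e he => ?_⟩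
  apply (toFree _).symm.injective
  refine Finsupp.ext fun a => ?_
  rw [free_proj_apply, map_zero, Finsupp.zero_apply]
  refine MvPolynomial.weightedHomogeneousComponent_eq_zero' _ _ fun d _ hd => he ((h a).trans ?_)
  rw [← sub_nonneg, ← hd]
  exact weight_varDegree_nonneg n d

theorem resolvable_free {A : ℕ → Set (Fin r → ℤ)} {ι : Type (max u v)} {b : ι → Fin r → ℤ}
    (h : ∀ a, b a ∈ A 0) : Resolvable A (free.{u, v} (k := k) (n := n) b) :=
  .of_step ⟨ι, b, h, ses_zero_left _⟩ (.of_subsingleton _)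

/-- Since `c ≤ b`, truncation has no effect, and adding the variables of `V` one at a time by
mapping cones produces the Koszul resolution. -/
theorem resolvable_varQuot_of_le {c : Fin r → ℤ} (V : Finset (Σ i : Fin r, Fin (n i + 1)))
    (b : Fin r → ℤ) (hb : c ≤ b) :
    Resolvable (linDegrees b) ((varQuot.{u, v} k n V b).trunc c) := by
  classical
  induction V using Finset.induction_on generalizing b with
  | empty =>
    refine Resolvable.of_ses_subsingleton ((ses_of_bijective (isGr_toVarQuot _ b)
      (bijective_toVarQuot_empty b)).trunc c) ?_
    refine Resolvable.of_ses_subsingleton (ses_of_bijective_symm (GrMod.isGr_truncIncl _ c)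
      (bijective_truncIncl_free fun _ => hb)) (resolvable_free fun _ => ⟨0, by simp, ?_⟩)
    funext t
    simp
  | insert x V hx ih =>
    refine Resolvable.cone ((ses_varQuot hx b).trunc c) ?_ (ih b hb)
    refine (ih (b + Pi.single x.1 1) (hb.trans (le_add_of_nonneg_right ?_))).mono
      fun j => linDegrees_add_single_subset b x.1 j
    exact Pi.single_nonneg.2 zero_le_one

/-- Modulo all variables of block `i` the module is concentrated in degrees with `i`-th coordinate
`b i`, all of which the truncation removes. -/
theorem subsingleton_trunc_varQuot {V : Finset (Σ i : Fin r, Fin (n i + 1))} {i : Fin r}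
    (hV : ∀ j, (⟨i, j⟩ : Σ i : Fin r, Fin (n i + 1)) ∈ V) {b c : Fin r → ℤ} (hbc : b i < c i) :
    Subsingleton ((varQuot.{u, v} k n V b).trunc c) := by
  refine subsingleton_of_forall_eq 0 fun m => GrMod.truncIncl_injective _ c ?_
  rw [map_zero]
  refine GrMod.ext_proj _ fun e => ?_
  rw [map_zero]
  by_cases he : c ≤ e
  · obtain ⟨p, hp⟩ := exists_toVarQuot_eq ((varQuot.{u, v} k n V b).truncIncl c m)
    rw [← hp, ← isGr_toVarQuot, freeOne_proj, toVarQuot_eq_zero]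
    refine mem_varIdeal_of_weight_pos hV (e := e - b) ?_
      (MvPolynomial.weightedHomogeneousComponent_isWeightedHomogeneous _ _)
    rw [Pi.sub_apply, sub_pos]
    exact hbc.trans_le (he i)
  · exact GrMod.exists_truncIncl_iff.1 ⟨m, rfl⟩ e he

theorem resolvable_trunc_varQuot (c : Fin r → ℤ) (V : Finset (Σ i : Fin r, Fin (n i + 1)))
    (b : Fin r → ℤ) : Resolvable (linDegrees (b ⊔ c)) ((varQuot.{u, v} k n V b).trunc c) := by
  classical
  -- The measure adds the shortfall of `b` below `c` to the number of variables outside `V`. In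
  -- `ses_varQuot` the left term lowers the first summand and the right term the second.
  induction hN : ∑ i, (c i - b i).toNat + Vᶜ.card using Nat.strong_induction_on generalizing V b with
  | _ N ih =>
  by_cases hb : c ≤ b
  · rw [sup_of_le_left hb]
    exact resolvable_varQuot_of_le V b hb
  obtain ⟨i, hi⟩ : ∃ i, b i < c i := by simpa [Pi.le_def] using hb
  by_cases hV : ∀ j, (⟨i, j⟩ : Σ i : Fin r, Fin (n i + 1)) ∈ V
  · have := subsingleton_trunc_varQuot.{u, v} (k := k) hV hi
    exact Resolvable.of_subsingleton _
  push Not at hV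
  obtain ⟨j, hj⟩ := hV
  refine Resolvable.ext ((ses_varQuot hj b).trunc c) ?_ (ih _ ?_ _ _ rfl)
  -- As `b i < c i`, raising `b i` by one does not pass `c i`. Both outer terms are thus generated
  -- in the same degree, and an extension suffices where a cone would not keep track of `b ⊔ c`.
  · have h1 : (b + Pi.single i 1) ⊔ c = b ⊔ c := by
      funext t
      by_cases h : t = i
      · subst h
        simp only [Pi.sup_apply, Pi.add_apply, Pi.single_eq_same]
        omega
      · simp [h]
    rw [← h1]
    refine ih _ ?_ _ _ rfl
    rw [← hN]
    refine Nat.add_lt_add_right (Finset.sum_lt_sum (fun t _ => ?_) ⟨i, Finset.mem_univ _, ?_⟩) _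
    · refine Int.toNat_le_toNat (sub_le_sub_left ?_ _)
      exact (le_add_of_nonneg_right (Pi.single_nonneg.2 zero_le_one) : b ≤ b + Pi.single i 1) t
    · simp only [Pi.add_apply, Pi.single_eq_same]
      omega
  · rw [← hN]
    refine Nat.add_lt_add_left (Finset.card_lt_card ?_) _
    rw [Finset.compl_ssubset_compl]
    exact Finset.ssubset_insert hj

theorem resolvable_trunc_freeOne (b c : Fin r → ℤ) :
    Resolvable (linDegrees (b ⊔ c)) ((freeOne.{u, v} k n b).trunc c) :=
  (resolvable_trunc_varQuot c ∅ b).of_ses_subsingleton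
    ((ses_of_bijective_symm (isGr_toVarQuot _ b) (bijective_toVarQuot_empty b)).trunc c)

/-! ### Resolvability versus graded free resolutions -/

theorem Resolvable.exists_seq {A : ℕ → Set (Fin r → ℤ)} {X : GrMod.{u, v} k n}
    (h : Resolvable A X) :
    ∃ K : ℕ → GrMod.{u, v} k n, K 0 = X ∧ ∀ j, Step (A j) (K j) (K (j + 1)) := by
  obtain ⟨P, hP, h⟩ := h
  choose f hf hf' using h
  let g : ∀ j, {N : GrMod.{u, v} k n // P j N} := fun j =>
    Nat.rec ⟨X, hP⟩ (fun j N => ⟨f j N.1 N.2, hf' j N.1 N.2⟩) j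
  exact ⟨fun j => (g j).1, rfl, fun j => hf j (g j).1 (g j).2⟩

/-- Resolvability is the existence of a graded free resolution with prescribed degrees. -/
theorem resolvable_iff {N : Type v} [AddCommGroup N] [Module (CoxRing k n) N]
    {𝒩 : (Fin r → ℤ) → AddSubgroup N} {X : GrMod.{u, v} k n} (φ : N ≃ₗ[CoxRing k n] X)
    (hφ : ∀ e x, φ x ∈ X.piece e ↔ x ∈ 𝒩 e) (A : ℕ → Set (Fin r → ℤ)) :
    Resolvable A X ↔ ∃ F : GradedFreeResolution.{u, v, max u v} (k := k) (n := n) 𝒩,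
      ∀ j a, F.degree j a ∈ A j := by
  constructor
  · intro h
    obtain ⟨K, rfl, hK⟩ := h.exists_seq
    choose ι b hb i p hi hp inj ex surj using hK
    -- The differential is the cover of the next syzygy followed by its inclusion, so its image is
    -- that syzygy.
    have hdiff : ∀ j, Function.Exact (i j ∘ₗ p (j + 1)) (p j) := fun j x => by
      rw [ex j x]
      exact ⟨fun ⟨y, hy⟩ => (surj (j + 1) y).imp fun z hz => by rw [LinearMap.comp_apply, hz, hy],
        fun ⟨y, hy⟩ => ⟨_, hy⟩⟩
    refine ⟨{
      index := ι
      degree := b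
      diff := fun j => (toFree (b j)).symm.toLinearMap ∘ₗ (i j ∘ₗ p (j + 1)) ∘ₗ
        (toFree (b (j + 1))).toLinearMap
      aug := φ.symm.toLinearMap ∘ₗ p 0 ∘ₗ (toFree (b 0)).toLinearMap
      diff_mem := fun j e f hf => ?_
      aug_mem := fun e f hf => ?_
      exact_diff := fun j x => ?_
      exact_aug := fun x => ?_
      aug_surjective := φ.symm.surjective.comp ((surj 0).comp (toFree (b 0)).surjective) }, hb⟩
    · exact (mem_free_piece _ _ _).1 (((hi j).comp (hp (j + 1))).map_mem_piece
        ((mem_free_piece _ _ (toFree _ f)).2 hf))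
    · rw [← hφ]
      simp only [LinearMap.comp_apply, LinearEquiv.coe_coe, LinearEquiv.apply_symm_apply]
      exact (hp 0).map_mem_piece ((mem_free_piece _ _ (toFree _ f)).2 hf)
    · rw [← map_zero (toFree (b j)).symm]
      refine (toFree (b j)).symm.injective.eq_iff.trans ?_
      rw [LinearMap.comp_apply, LinearMap.comp_apply, map_eq_zero_iff _ (inj j)]
      exact hdiff (j + 1) _
    · rw [← map_zero φ.symm]
      exact φ.symm.injective.eq_iff.trans (hdiff 0 _)
  · rintro ⟨F, hF⟩
    let D : ∀ j, free.{u, v} (k := k) (n := n) (F.degree (j + 1)) →ₗ[CoxRing k n]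
        free.{u, v} (k := k) (n := n) (F.degree j) := fun j =>
      (toFree (F.degree j)).toLinearMap ∘ₗ F.diff j ∘ₗ
        (toFree (F.degree (j + 1))).symm.toLinearMap
    have hD : ∀ j, IsGr _ _ (D j) := fun j => IsGr.of_mem_piece fun e m hm =>
      (mem_free_piece _ _ _).2 (F.diff_mem j e _ ((mem_free_piece _ _ _).1 hm))
    -- The `j`-th syzygies are characterized as the cokernels of the differential into the `j`-th
    -- term.
    refine ⟨fun j Y => ∃ p : free.{u, v} (k := k) (n := n) (F.degree j) →ₗ[CoxRing k n] Y,
      IsGr _ _ p ∧ Function.Surjective p ∧ Function.Exact (D j) p, ?_, ?_⟩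
    · refine ⟨φ.toLinearMap ∘ₗ F.aug ∘ₗ (toFree (F.degree 0)).symm.toLinearMap,
        IsGr.of_mem_piece fun e m hm => (hφ _ _).2 (F.aug_mem e _ ((mem_free_piece _ _ _).1 hm)),
        φ.surjective.comp (F.aug_surjective.comp (toFree _).symm.surjective), fun x => ?_⟩
      rw [← map_zero φ]
      exact φ.injective.eq_iff.trans (F.exact_aug _)
    · rintro j Y ⟨p, hp, surj, ex⟩
      obtain ⟨K, i, hi, inj, ex'⟩ := exists_ker p hp
      obtain ⟨q, hq, hiq⟩ := exists_lift_of_injective hi inj (hD j) fun x =>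
        (ex' _).1 ((ex _).2 ⟨x, rfl⟩)
      refine ⟨K, ⟨_, _, hF j, i, p, hi, hp, inj, ex', surj⟩, q, hq, fun y => ?_, fun x => ?_⟩
      · obtain ⟨x, hx⟩ := (ex _).1 ((ex' (i y)).2 ⟨y, rfl⟩)
        exact ⟨x, inj ((hiq x).trans hx)⟩
      · rw [← map_eq_zero_iff _ inj, hiq]
        exact F.exact_diff j _

/-- A module resolved from a single degree `e` lives in degrees `≥ e`. -/
theorem Resolvable.proj_eq_zero {A : ℕ → Set (Fin r → ℤ)} {X : GrMod.{u, v} k n}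
    (h : Resolvable A X) {e : Fin r → ℤ} (hA : ∀ b ∈ A 0, b = e) {f : Fin r → ℤ} (hf : ¬ e ≤ f)
    (x : X) : X.proj f x = 0 := by
  obtain ⟨K, ⟨ι, b, hb, i, p, hi, hp, inj, ex, surj⟩, -⟩ := h.exists_step
  obtain ⟨y, rfl⟩ := surj x
  obtain ⟨z, rfl⟩ := (bijective_truncIncl_free (c := e) fun a => (hA _ (hb a)).ge).2 y
  rw [← hp, GrMod.exists_truncIncl_iff.1 ⟨z, rfl⟩ f hf, map_zero]

/-! ### Reduction to a truncation at d' ⊔ e -/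

/-- Iterated truncation. -/
theorem Resolvable.trunc_of_le {A B : ℕ → Set (Fin r → ℤ)} {X : GrMod.{u, v} k n}
    {d d' e : Fin r → ℤ} (hd : d ≤ d') (h : Resolvable A (X.trunc d)) (hA : ∀ b ∈ A 0, b = e)
    (hB : Resolvable B ((X.trunc d).trunc (d' ⊔ e))) : Resolvable B (X.trunc d') := by
  have h1 : IsGr _ _ (X.truncIncl d ∘ₗ (X.trunc d).truncIncl (d' ⊔ e)) :=
    (X.isGr_truncIncl d).comp ((X.trunc d).isGr_truncIncl _)
  have hinj : Function.Injective (X.truncIncl d ∘ₗ (X.trunc d).truncIncl (d' ⊔ e)) :=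
    (X.truncIncl_injective d).comp ((X.trunc d).truncIncl_injective _)
  obtain ⟨f, hf, hff⟩ := exists_lift_of_injective (X.isGr_truncIncl d') (X.truncIncl_injective d')
    h1 fun x => GrMod.exists_truncIncl_iff.2 fun g hg => by
      rw [← h1, GrMod.ext_proj _ (x := GrMod.proj _ g x) (y := 0), map_zero]
      intro g'
      rw [map_zero]
      by_cases hgg : g' = g
      · subst hgg
        rw [GrMod.proj_proj]
        apply (X.trunc d).truncIncl_injective
        rw [(X.trunc d).isGr_truncIncl, map_zero]
        exact GrMod.exists_truncIncl_iff.1 ⟨x, rfl⟩ _ fun h => hg (le_sup_left.trans h)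
      · exact GrMod.proj_proj_ne _ _ _ _ hgg
  refine hB.of_ses_subsingleton (ses_of_bijective hf ⟨fun x y hxy => hinj ?_, fun y => ?_⟩)
  · rw [← hff, hxy, hff]
  · have hy := GrMod.exists_truncIncl_iff.1 ⟨y, rfl⟩
    obtain ⟨z, hz⟩ := (GrMod.exists_truncIncl_iff (c := d)).2 fun g hg =>
      hy g fun h => hg (hd.trans h)
    -- Components of `z` in degrees not ≥ d' vanish because `y` lies in the truncation at `d'`;
    -- those in degrees not ≥ e vanish because the resolution starts in degree `e`.
    obtain ⟨w, hw⟩ := (GrMod.exists_truncIncl_iff (c := d' ⊔ e) (m := z)).2 fun g hg => by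
      by_cases hge : e ≤ g
      · apply X.truncIncl_injective d
        rw [X.isGr_truncIncl, hz, map_zero]
        exact hy g fun h => hg (sup_le h hge)
      · exact h.proj_eq_zero hA hge z
    refine ⟨w, X.truncIncl_injective d' ?_⟩
    rw [hff, LinearMap.comp_apply, hw, hz]

/-! ### Internally graded modules and their truncations -/

section Internal

variable {M : Type v} [AddCommGroup M] [Module (CoxRing k n) M]
  (𝓜 : (Fin r → ℤ) → AddSubgroup M) [DirectSum.Decomposition 𝓜]

theorem decompose_smul_add [SetLike.GradedSMul (coxGrading k n) 𝓜] {a : Fin r → ℤ}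
    {s : CoxRing k n} (hs : s ∈ coxGrading k n a) (e : Fin r → ℤ) (m : M) :
    (DirectSum.decompose 𝓜 (s • m) (a + e) : M) = s • (DirectSum.decompose 𝓜 m e : M) := by
  induction m using DirectSum.Decomposition.inductionOn 𝓜 with
  | zero => simp
  | @homogeneous i m =>
    have h : s • (m : M) ∈ 𝓜 (a + i) := SetLike.GradedSMul.smul_mem (B := 𝓜) hs m.2
    by_cases hi : i = e
    · subst hi
      rw [DirectSum.decompose_of_mem_same 𝓜 h, DirectSum.decompose_of_mem_same 𝓜 m.2]
    · rw [DirectSum.decompose_of_mem_ne 𝓜 h (fun h' => hi (add_left_cancel h')),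
        DirectSum.decompose_of_mem_ne 𝓜 m.2 hi, smul_zero]
  | add m m' h h' =>
    rw [smul_add, DirectSum.decompose_add, DirectSum.decompose_add, DirectSum.add_apply,
      DirectSum.add_apply, AddSubgroup.coe_add, AddSubgroup.coe_add, h, h', smul_add]

/-- An internally graded module as a `GrMod`. -/
noncomputable def ofDecomposition [SetLike.GradedSMul (coxGrading k n) 𝓜] :
    GrMod.{u, v} k n where
  carrier := ULift.{u} M
  proj e :=
    { toFun := fun m => ULift.up (DirectSum.decompose 𝓜 m.down e : M)
      map_zero' := by
        apply ULift.down_injective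
        simp
      map_add' := fun x y => by
        apply ULift.down_injective
        simp }
  proj_proj e m := ULift.down_injective
    (DirectSum.decompose_of_mem_same 𝓜 (DirectSum.decompose 𝓜 m.down e).2)
  proj_proj_ne e e' m h := ULift.down_injective
    (DirectSum.decompose_of_mem_ne 𝓜 (DirectSum.decompose 𝓜 m.down e').2 h.symm)
  exists_sum m := by
    classical
    refine ⟨(DirectSum.decompose 𝓜 m.down).support, ULift.down_injective ?_⟩
    refine (map_sum (ULift.moduleEquiv (R := CoxRing k n) (M := M)) _ _).trans ?_
    exact DirectSum.sum_support_decompose 𝓜 m.down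
  proj_smul a e s hs m := ULift.down_injective (decompose_smul_add 𝓜 hs e m.down)

theorem mem_truncation_iff [SetLike.GradedSMul (coxGrading k n) 𝓜] (d : Fin r → ℤ) (m : M) :
    m ∈ truncation k n 𝓜 d ↔ ∀ e, ¬ d ≤ e → (DirectSum.decompose 𝓜 m e : M) = 0 := by
  classical
  change m ∈ (⨆ e : {e : Fin r → ℤ // d ≤ e}, 𝓜 e : AddSubgroup M) ↔ _
  constructor
  · intro hm e he
    induction hm using AddSubgroup.iSup_induction' with
    | hp i x hx => exact DirectSum.decompose_of_mem_ne 𝓜 hx fun h => he (h ▸ i.2)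
    | h1 => simp
    | hadd x y _ _ hx hy => simp [hx, hy]
  · intro h
    rw [← DirectSum.sum_support_decompose 𝓜 m]
    refine AddSubgroup.sum_mem _ fun e _ => ?_
    by_cases he : d ≤ e
    · exact (le_iSup (fun e : {e : Fin r → ℤ // d ≤ e} => 𝓜 e) ⟨e, he⟩)
        (DirectSum.decompose 𝓜 m e).2
    · rw [h e he]
      exact zero_mem _

theorem mem_ofDecomposition_truncSubmodule [SetLike.GradedSMul (coxGrading k n) 𝓜]
    (d : Fin r → ℤ) (m : M) :
    (ULift.up m : ULift.{u} M) ∈ (ofDecomposition.{u, v} (k := k) (n := n) 𝓜).truncSubmodule d ↔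
      m ∈ truncation k n 𝓜 d := by
  rw [mem_truncation_iff]
  exact forall₂_congr fun e _ => ULift.down_injective.eq_iff.symm

/-- The two descriptions of the truncation agree. -/
noncomputable def truncationEquiv [SetLike.GradedSMul (coxGrading k n) 𝓜] (d : Fin r → ℤ) :
    truncation k n 𝓜 d ≃ₗ[CoxRing k n] (ofDecomposition.{u, v} (k := k) (n := n) 𝓜).trunc d where
  toFun m := ⟨ULift.up m, (mem_ofDecomposition_truncSubmodule 𝓜 d m).2 m.2⟩
  invFun m := ⟨m.1.down, (mem_ofDecomposition_truncSubmodule 𝓜 d m.1.down).1 m.2⟩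
  map_add' _ _ := rfl
  map_smul' _ _ := rfl
  left_inv _ := rfl
  right_inv _ := rfl

theorem truncationEquiv_mem_piece [SetLike.GradedSMul (coxGrading k n) 𝓜] (d e : Fin r → ℤ)
    (x : truncation k n 𝓜 d) :
    truncationEquiv.{u, v} (k := k) (n := n) 𝓜 d x ∈ ((ofDecomposition.{u, v} (k := k) (n := n) 𝓜).trunc d).piece e ↔
      x ∈ truncationGrading k n 𝓜 d e := by
  have h1 : truncationEquiv.{u, v} (k := k) (n := n) 𝓜 d x ∈ ((ofDecomposition.{u, v} (k := k) (n := n) 𝓜).trunc d).piece e ↔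
      (DirectSum.decompose 𝓜 (x : M) e : M) = x :=
    Subtype.ext_iff.trans ULift.down_injective.eq_iff.symm
  rw [h1]
  change _ ↔ (x : M) ∈ 𝓜 e
  exact ⟨fun h => h ▸ (DirectSum.decompose 𝓜 (x : M) e).2,
    fun h => DirectSum.decompose_of_mem_same 𝓜 h⟩

/-- The common form of both statements: `R j e` is the region of degrees allowed in the `j`-th
term of a resolution generated in degree `e`. -/
theorem truncation_resolution [SetLike.GradedSMul (coxGrading k n) 𝓜]
    (R : ℕ → (Fin r → ℤ) → Set (Fin r → ℤ))
    (hR : ∀ (e c : Fin r → ℤ), e ≤ c → ∀ j i b, -b ∈ R j (-e) → ∀ b' ∈ linDegrees (b ⊔ c) i,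
      -b' ∈ R (j + i) (-c))
    {d d' : Fin r → ℤ} (hd : d ≤ d')
    (h : ∃ F : GradedFreeResolution.{u, v, max u v} (k := k) (n := n) (truncationGrading k n 𝓜 d),
      ∃ e : Fin r → ℤ, (∀ a, F.degree 0 a = e) ∧ ∀ j a, -F.degree j a ∈ R j (-e)) :
    ∃ F : GradedFreeResolution.{u, v, max u v} (k := k) (n := n) (truncationGrading k n 𝓜 d'),
      ∃ e : Fin r → ℤ, (∀ a, F.degree 0 a = e) ∧ ∀ j a, -F.degree j a ∈ R j (-e) := by
  obtain ⟨F, e, hF0, hF⟩ := h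
  -- The region for `j = 0` only bounds the degree by `e`; generation in exactly the degree `e` has
  -- to be recorded separately.
  let A : (Fin r → ℤ) → ℕ → Set (Fin r → ℤ) := fun e j => {b | (j = 0 → b = e) ∧ -b ∈ R j (-e)}
  have h1 : Resolvable (A e) ((ofDecomposition.{u, v} (k := k) (n := n) 𝓜).trunc d) :=
    (resolvable_iff (truncationEquiv.{u, v} (k := k) (n := n) 𝓜 d) (truncationEquiv_mem_piece 𝓜 d) _).2
      ⟨F, fun j a => ⟨by rintro rfl; exact hF0 a, hF j a⟩⟩
  have h2 : Resolvable (A (d' ⊔ e)) (((ofDecomposition.{u, v} (k := k) (n := n) 𝓜).trunc d).trunc (d' ⊔ e)) := by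
    refine h1.trunc fun j b hb => (resolvable_trunc_freeOne b (d' ⊔ e)).mono fun i b' hb' => ?_
    refine ⟨fun hji => ?_, hR e _ le_sup_right j i b hb.2 b' hb'⟩
    obtain ⟨rfl, rfl⟩ : j = 0 ∧ i = 0 := by omega
    obtain ⟨l, hl, rfl⟩ := hb'
    rw [hb.1 rfl, sup_of_le_right le_sup_right]
    funext t
    simp [(Finset.sum_eq_zero_iff.1 hl) t (Finset.mem_univ t)]
  obtain ⟨F', hF'⟩ := (resolvable_iff (truncationEquiv.{u, v} (k := k) (n := n) 𝓜 d') (truncationEquiv_mem_piece 𝓜 d') _).1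
    (h1.trunc_of_le hd (fun b hb => hb.1 rfl) h2)
  exact ⟨F', d' ⊔ e, fun a => (hF' 0 a).1 rfl, fun j a => (hF' j a).2⟩

end Internal

/-! ### Stability of the degree regions -/

/-- From b ≤ e + l and e ≤ c follows b ⊔ c ≤ c + l; adding the linear shift `m` gives the witness l
+ m. -/
theorem regionL_truncation {e c : Fin r → ℤ} (hec : e ≤ c) {j i : ℕ} {b : Fin r → ℤ}
    (hb : -b ∈ regionL j (-e)) {b' : Fin r → ℤ} (hb' : b' ∈ linDegrees (b ⊔ c) i) :
    -b' ∈ regionL (j + i) (-c) := by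
  obtain ⟨l, hl, hle⟩ := hb
  obtain ⟨m, hm, rfl⟩ := hb'
  refine ⟨l + m, by simp [Finset.sum_add_distrib, hl, hm], fun t => ?_⟩
  have h1 := hle t
  have h2 := hec t
  simp only [Pi.sub_apply, Pi.neg_apply, Pi.add_apply, Pi.sup_apply, Nat.cast_add] at *
  omega

theorem regionQ_truncation {e c : Fin r → ℤ} (hec : e ≤ c) {j i : ℕ} {b : Fin r → ℤ}
    (hb : -b ∈ regionQ j (-e)) {b' : Fin r → ℤ} (hb' : b' ∈ linDegrees (b ⊔ c) i) :
    -b' ∈ regionQ (j + i) (-c) := by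
  obtain ⟨m, hm, rfl⟩ := hb'
  rcases j with _ | j
  · have hbe : -e ≤ -b := hb
    rcases i with _ | i
    · change -c ≤ _
      intro t
      have h1 := hbe t
      have h2 := hec t
      have h3 := (Finset.sum_eq_zero_iff.1 hm) t (Finset.mem_univ t)
      simp only [Pi.neg_apply, Pi.add_apply, Pi.sup_apply, h3] at *
      omega
    · rw [zero_add]
      obtain ⟨t₀, -, ht₀⟩ := Finset.exists_ne_zero_of_sum_ne_zero (hm.trans_ne i.succ_ne_zero)
      -- Here b ≤ e ≤ c, so the degree is c + m with |m| = i + 1, while the region allows only a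
      -- vector of size `i`. The unit removed at `t₀` is restored by the shift by **1**.
      refine ⟨m - Pi.single t₀ 1, ?_, fun t => ?_⟩
      · have h1 : m - Pi.single t₀ 1 + (Pi.single t₀ 1 : Fin r → ℕ) = m := by
          funext t
          by_cases h : t = t₀
          · subst h
            simp
            omega
          · simp [h]
        have h2 : ∑ t, (m - Pi.single t₀ 1 + Pi.single t₀ 1 : Fin r → ℕ) t = i + 1 := by rw [h1, hm]
        simpa [Finset.sum_add_distrib] using h2
      · have h1 := hbe t
        have h2 := hec t
        by_cases h : t = t₀
        · subst h
          simp only [Pi.sub_apply, Pi.neg_apply, Pi.add_apply, Pi.sup_apply, Pi.single_eq_same,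
            Pi.one_apply] at *
          omega
        · simp only [Pi.sub_apply, Pi.neg_apply, Pi.add_apply, Pi.sup_apply,
            Pi.single_eq_of_ne h, Pi.one_apply] at *
          omega
  · obtain ⟨l, hl, hle⟩ := hb
    rw [Nat.add_right_comm]
    -- For positive homological degree the shift by **1** is already present in the bound for `b`,
    -- and the argument is that of the linear case.
    refine ⟨l + m, by simp [Finset.sum_add_distrib, hl, hm], fun t => ?_⟩
    have h1 := hle t
    have h2 := hec t
    simp only [Pi.sub_apply, Pi.neg_apply, Pi.add_apply, Pi.sup_apply, Nat.cast_add,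
      Pi.one_apply] at *
    omega

end

end Multigraded

theorem mainTheorem11 {k : Type*} [Field k] {r : ℕ} (n : Fin r → ℕ)
    {M : Type*} [AddCommGroup M] [Module (Multigraded.CoxRing k n) M]
    (𝓜 : (Fin r → ℤ) → AddSubgroup M) [DirectSum.Decomposition 𝓜]
    [SetLike.GradedSMul (Multigraded.coxGrading k n) 𝓜]
    (d d' : Fin r → ℤ) (hd : d ≤ d') :
    (Multigraded.HasLinearResolution k n (Multigraded.truncationGrading k n 𝓜 d) →
      Multigraded.HasLinearResolution k n
        (Multigraded.truncationGrading k n 𝓜 d')) ∧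
    (Multigraded.HasQuasilinearResolution k n
        (Multigraded.truncationGrading k n 𝓜 d) →
      Multigraded.HasQuasilinearResolution k n
        (Multigraded.truncationGrading k n 𝓜 d')) :=
  ⟨Multigraded.truncation_resolution 𝓜 Multigraded.regionL
      (fun _ _ h _ _ _ hb _ hb' => Multigraded.regionL_truncation h hb hb') hd,
    Multigraded.truncation_resolution 𝓜 Multigraded.regionQ
      (fun _ _ h _ _ _ hb _ hb' => Multigraded.regionQ_truncation h hb hb') hd⟩
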